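/- Let $n\ge 2$. A convex body in $\mathbb R^n$ is a non-empty compact convex subset of $\mathbb R^n$. Let $S^{n-1}$ be the unit sphere of $\mathbb R^n$ and $\sigma$ the spherical Lebesgue measure on it. For $m\ge 0$, let $\mathcal H^n_m$ be the space of spherical harmonics of order $m$, i.e. of restrictions to $S^{n-1}$ of real harmonic homogeneous polynomials of degree $m$ on $\mathbb R^n$ (including $0$), and let $\pi_m : C(S^{n-1})\to\mathcal H^n_m$ be the orthogonal projection with respect to the scalar product $(f,g)=\int_{S^{n-1}} fg\,d\sigma$. For a convex body $K$, let $h_K(u)=\max\{\langle u,y\rangle : y\in K\}$, $u\in S^{n-1}$, be the restriction of its support function to $S^{n-1}$. The body $K$ is called universal if $\pi_m h_K\neq 0$ for all integers $m\ge 0$, and centrally universal if $\pi_m h_K\ne 0$ for all even integers $m\ge 0$. Linear maps of $\mathbb R^n$ are identified with their matrices, i.e. with points of $\mathbb R^{n^2}$. **Theorem 3.** (a) Let $K$ be a convex body in $\mathbb R^n$ that has no centre of symmetry. Then every neighbourhood $U$ of the identity contains an invertible linear map $A$ such that $AK$ is universal. In fact, for almost all $A\in U$, with respect to Lebesgue measure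 on $\mathbb R^{n^2}$, the body $AK$ is universal. (b) Let $K$ be a convex body in $\mathbb R^n$ with more than one point. Then every neighbourhood $U$ of the identity contains an invertible linear map $A$ such that $AK$ is centrally universal. In fact, for almost all $A\in U$, with respect to Lebesgue measure on $\mathbb R^{n^2}$, the body $AK$ is centrally universal. -/

import Mathlib

open MeasureTheory Topology

/-- The unit sphere `S^{n-1}` of `ℝⁿ`. -/
abbrev UnitSphere (n : ℕ) : Type := Metric.sphere (0 : EuclideanSpace ℝ (Fin n)) 1

/-- The spherical Lebesgue measure `σ` on `S^{n-1}`. -/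
noncomputable def sphereMeasure (n : ℕ) : Measure (UnitSphere n) :=
  (volume : Measure (EuclideanSpace ℝ (Fin n))).toSphere

instance sphereMeasure_isFiniteMeasure (n : ℕ) : IsFiniteMeasure (sphereMeasure n) := by
  unfold sphereMeasure; infer_instance

instance sphereMeasure_isOpenPosMeasure (n : ℕ) : (sphereMeasure n).IsOpenPosMeasure := by
  unfold sphereMeasure; infer_instance

/-- The restriction of a real polynomial in `n` variables to `S^{n-1}`. -/
noncomputable def polyRestrict (n : ℕ) : MvPolynomial (Fin n) ℝ →ₗ[ℝ] C(UnitSphere n, ℝ) where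
  toFun p :=
    { toFun := fun u => MvPolynomial.eval (fun i => u.1 i) p
      continuous_toFun := p.continuous_eval.comp (by fun_prop) }
  map_add' p q := by ext u; simp
  map_smul' c p := by ext u; simp

/-- The Laplace operator `∑ᵢ ∂²/∂xᵢ²` on real polynomials in `n` variables. -/
noncomputable def polyLaplacian (n : ℕ) :
    MvPolynomial (Fin n) ℝ →ₗ[ℝ] MvPolynomial (Fin n) ℝ :=
  ∑ i : Fin n, (MvPolynomial.pderiv i).toLinearMap ∘ₗ (MvPolynomial.pderiv i).toLinearMap

/-- The space `ℋ^n_m` of spherical harmonics of dimension `n` and order `m`: the restrictions to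
the sphere of the harmonic homogeneous polynomials of degree `m` (together with `0`). -/
noncomputable def sphericalHarmonics (n m : ℕ) : Submodule ℝ C(UnitSphere n, ℝ) :=
  (MvPolynomial.homogeneousSubmodule (Fin n) ℝ m ⊓ LinearMap.ker (polyLaplacian n)).map
    (polyRestrict n)

instance sphericalHarmonics_finiteDimensional (n m : ℕ) :
    FiniteDimensional ℝ (sphericalHarmonics n m) := by
  have h : FiniteDimensional ℝ (MvPolynomial.homogeneousSubmodule (Fin n) ℝ m) :=
    Module.Finite.iff_fg.mpr (MvPolynomial.homogeneousSubmodule_fg (Fin n) ℝ m)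
  have h2 : FiniteDimensional ℝ
      (MvPolynomial.homogeneousSubmodule (Fin n) ℝ m ⊓ LinearMap.ker (polyLaplacian n) :
        Submodule ℝ (MvPolynomial (Fin n) ℝ)) :=
    Submodule.finiteDimensional_of_le inf_le_left
  unfold sphericalHarmonics
  infer_instance

/-- The inclusion of `C(S^{n-1})` in the Hilbert space `L²(σ)`, which induces on `C(S^{n-1})` the
scalar product `(f, g) = ∫ f g dσ`. -/
noncomputable def sphereToL2 (n : ℕ) : C(UnitSphere n, ℝ) →ₗ[ℝ] Lp ℝ 2 (sphereMeasure n) :=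
  (ContinuousMap.toLp (E := ℝ) 2 (sphereMeasure n) ℝ).toLinearMap

theorem sphereToL2_injective (n : ℕ) : Function.Injective (sphereToL2 n) :=
  ContinuousMap.toLp_injective (sphereMeasure n)

/-- The orthogonal projection `π_m : C(S^{n-1}) → ℋ^n_m` with respect to the scalar product
`(f, g) = ∫ f g dσ`. -/
noncomputable def harmonicProj (n m : ℕ) : C(UnitSphere n, ℝ) →ₗ[ℝ] sphericalHarmonics n m :=
  (Submodule.equivMapOfInjective (sphereToL2 n) (sphereToL2_injective n)
      (sphericalHarmonics n m)).symm.toLinearMap ∘ₗ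
    ((sphericalHarmonics n m).map (sphereToL2 n)).orthogonalProjectionOnto.toLinearMap ∘ₗ
      sphereToL2 n

/-- The restriction `h_K` to `S^{n-1}` of the support function
`h(K, x) = max {⟪x, y⟫ | y ∈ K}` of a convex body `K` in `ℝⁿ`. -/
noncomputable def supportFn {n : ℕ} (K : ConvexBody (EuclideanSpace ℝ (Fin n))) :
    C(UnitSphere n, ℝ) where
  toFun u := sSup ((fun y : EuclideanSpace ℝ (Fin n) => inner ℝ u.1 y) '' (K : Set _))
  continuous_toFun := K.isCompact.continuous_sSup (by fun_prop)

/-- The image `AK` of a convex body `K` in `ℝⁿ` under the linear map with matrix `A`. -/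
noncomputable def linearImage {n : ℕ} (A : Matrix (Fin n) (Fin n) ℝ)
    (K : ConvexBody (EuclideanSpace ℝ (Fin n))) : ConvexBody (EuclideanSpace ℝ (Fin n)) where
  carrier := Matrix.toEuclideanLin A '' (K : Set _)
  convex' := K.convex.linear_image _
  isCompact' := K.isCompact.image (Matrix.toEuclideanLin A).continuous_of_finiteDimensional
  nonempty' := K.nonempty.image _

/-- `K` is symmetric: it has a centre of symmetry `c`. -/
def HasCentreOfSymmetry {n : ℕ} (K : ConvexBody (EuclideanSpace ℝ (Fin n))) : Prop :=
  ∃ c : EuclideanSpace ℝ (Fin n), ∀ x ∈ K, (2 : ℝ) • c - x ∈ K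

/-- `K` is universal: `π_m h_K ≠ 0` for all `m ≥ 0`. -/
def IsUniversal {n : ℕ} (K : ConvexBody (EuclideanSpace ℝ (Fin n))) : Prop :=
  ∀ m : ℕ, harmonicProj n m (supportFn K) ≠ 0

/-- `K` is centrally universal: `π_m h_K ≠ 0` for all even `m ≥ 0`. -/
def IsCentrallyUniversal {n : ℕ} (K : ConvexBody (EuclideanSpace ℝ (Fin n))) : Prop :=
  ∀ m : ℕ, Even m → harmonicProj n m (supportFn K) ≠ 0

/-! Fix an order m and write h for the support function of K, so that that of AK is h ∘ Aᵀ. If the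
projection of order m of h ∘ Aᵀ vanishes, then h ∘ Aᵀ is orthogonal on the sphere to ⟨p + iq, ·⟩^m
for every isotropic pair (p ⊥ q, ‖p‖ = ‖q‖), because these powers are harmonic. By homogeneity the
sphere can be replaced by the whole space with a Gaussian weight (`gaussCoeff`).

The substitution x = Dy, with D a positive multiple of the inverse of Aᵀ, moves A out of the merely
continuous h into a polynomial times a Gaussian. So each coefficient is, up to a non-zero factor,
real analytic in A where det A ≠ 0. Hence either the coefficients of order m vanish simultaneously
for almost no A (`ae_not_coeffsVanish`), or they all vanish on an open set. In the second case polar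
decomposition and analytic continuation along positive definite matrices give vanishing for all
invertible A, and continuity gives it for singular A (`coeffsVanish_of_ball`).

Matrices of rank at most two then yield ∫ h(Lz) z^m exp(-|z|²/2) = 0 for all linear L : ℂ → ℝⁿ.
Replacing z by z + βz̄ and differentiating at β = 0 links the orders m and m + 2 in both directions,
except that order 3 does not descend to order 1. For even m one reaches order 0, where the
non-negative width h(x) + h(-x) must vanish, so K is a point. For odd m all odd orders from 3 on
vanish, so h(x) - h(-x) is linear on every plane, and K has a centre. A countable union over m
finishes the proof. -/

/-! ### Polar coordinates and null sets of zeros. -/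

section Radial

variable {E : Type*} [NormedAddCommGroup E] [NormedSpace ℝ E] [MeasurableSpace E] [BorelSpace E]
  [FiniteDimensional ℝ E] (μ : Measure E) [μ.IsAddHaarMeasure]

/-- Integration in polar coordinates of a positively homogeneous function times a radial one. -/
theorem integral_homogeneous_mul_radial [Nontrivial E] (Φ : E → ℂ) (k : ℕ)
    (hΦ : ∀ r : ℝ, 0 < r → ∀ x, Φ (r • x) = (r : ℂ) ^ k * Φ x) (ρ : ℝ → ℂ) :
    ∫ x, Φ x * ρ ‖x‖ ∂μ = (∫ u : Metric.sphere (0 : E) 1, Φ u ∂μ.toSphere) *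
      ∫ r in Set.Ioi (0 : ℝ), (r : ℂ) ^ (Module.finrank ℝ E - 1) * ((r : ℂ) ^ k * ρ r) := by
  calc
    ∫ x, Φ x * ρ ‖x‖ ∂μ = ∫ x : ({(0)}ᶜ : Set E), Φ x.1 * ρ (‖x.1‖) ∂(μ.comap (↑)) := by
      rw [integral_subtype_comap (measurableSet_singleton _).compl fun x ↦ Φ x * ρ (‖x‖),
        restrict_compl_singleton]
    _ = ∫ x : Metric.sphere (0 : E) 1 × Set.Ioi (0 : ℝ), Φ x.1 * ((x.2 : ℂ) ^ k * ρ x.2)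
          ∂μ.toSphere.prod (.volumeIoiPow (Module.finrank ℝ E - 1)) := by
      rw [← μ.measurePreserving_homeomorphUnitSphereProd.integral_comp
        (Homeomorph.measurableEmbedding _)]
      congr 1
      ext x
      have hx : 0 < ‖x.1‖ := norm_pos_iff.2 x.2
      simp only [homeomorphUnitSphereProd_apply_fst_coe, homeomorphUnitSphereProd_apply_snd_coe]
      have h := hΦ ‖x.1‖ hx (‖x.1‖⁻¹ • x.1)
      rw [smul_inv_smul₀ hx.ne'] at h
      rw [h]; ring
    _ = (∫ u : Metric.sphere (0 : E) 1, Φ u ∂μ.toSphere) *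
          ∫ r : Set.Ioi (0 : ℝ), ((r : ℂ) ^ k * ρ r) ∂.volumeIoiPow (Module.finrank ℝ E - 1) :=
      integral_prod_mul (fun u : Metric.sphere (0 : E) 1 => Φ u)
        (fun r : Set.Ioi (0 : ℝ) => (r : ℂ) ^ k * ρ r)
    _ = _ := by
      congr 1
      simp only [Measure.volumeIoiPow, ENNReal.ofReal]
      rw [integral_withDensity_eq_integral_smul, integral_subtype_comap measurableSet_Ioi
        fun a ↦ Real.toNNReal (a ^ (Module.finrank ℝ E - 1)) • ((a : ℂ) ^ k * ρ a),
        setIntegral_congr_fun measurableSet_Ioi fun x hx ↦ ?_]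
      · rw [NNReal.smul_def, Real.coe_toNNReal _ (pow_nonneg hx.out.le _), Complex.real_smul]
        push_cast; rfl
      · exact (measurable_subtype_coe.pow_const _).real_toNNReal

/-- A measurable set that meets almost no point of every ray from the origin is null. -/
theorem measure_eq_zero_of_forall_ray {Z : Set E} (hZ : MeasurableSet Z)
    (h : ∀ v : E, volume {r : ℝ | 0 < r ∧ r • v ∈ Z} = 0) : μ Z = 0 := by
  rcases subsingleton_or_nontrivial E with hE | hE
  · by_cases h0 : (0 : E) ∈ Z
    · have := h 0
      simp only [smul_zero, h0, and_true] at this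
      change volume (Set.Ioi (0 : ℝ)) = 0 at this
      simp at this
    · have : Z = ∅ := by
        ext x; rw [Subsingleton.elim x 0]; simp [h0]
      simp [this]
  have h1 : μ Z = (μ.comap (Subtype.val : ({(0 : E)}ᶜ : Set E) → E)) (Subtype.val ⁻¹' Z) := by
    rw [comap_subtype_coe_apply (measurableSet_singleton _).compl, Subtype.image_preimage_coe]
    apply le_antisymm _ (measure_mono Set.inter_subset_right)
    calc μ Z ≤ μ (({0}ᶜ ∩ Z) ∪ {0}) := measure_mono (fun x hx => by
              by_cases hx0 : x = 0
              · right; exact hx0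
              · left; exact ⟨hx0, hx⟩)
      _ ≤ μ ({0}ᶜ ∩ Z) + μ {0} := measure_union_le _ _
      _ = _ := by simp
  have mp := (μ.measurePreserving_homeomorphUnitSphereProd (E := E))
  have h2 := mp.measure_preimage_equiv (f := (homeomorphUnitSphereProd E).toMeasurableEquiv)
    ((homeomorphUnitSphereProd E).symm ⁻¹' (Subtype.val ⁻¹' Z))
  have h3 : ((homeomorphUnitSphereProd E).toMeasurableEquiv) ⁻¹'
      ((homeomorphUnitSphereProd E).symm ⁻¹' (Subtype.val ⁻¹' Z)) = Subtype.val ⁻¹' Z := by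
    ext x; simp
  have hm : MeasurableSet ((homeomorphUnitSphereProd E).symm ⁻¹'
      ((Subtype.val : ({(0 : E)}ᶜ : Set E) → E) ⁻¹' Z)) :=
    (homeomorphUnitSphereProd E).symm.measurable (measurable_subtype_coe hZ)
  -- Fubini on sphere × (0, ∞): every slice lies in a ray set that is null by `h`, and the radial
  -- measure is absolutely continuous.
  rw [h1, ← h3, h2, Measure.measure_prod_null hm]
  filter_upwards with v
  rw [Measure.volumeIoiPow]
  refine withDensity_absolutelyContinuous _ _ ?_
  rw [comap_subtype_coe_apply measurableSet_Ioi]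
  refine measure_mono_null ?_ (h v)
  rintro _ ⟨r, hr, rfl⟩
  exact ⟨r.2, by simpa using hr⟩

/-- A function that is analytic on the segments of an open convex set through a point where it
does not vanish has a null set of zeros. -/
theorem measure_zeros_eq_zero_of_analytic_on_lines {f : E → ℂ} {a : E} {S : Set E}
    (hS : Convex ℝ S) (hSo : IsOpen S) (haS : a ∈ S)
    (hf : ∀ v : E, AnalyticOnNhd ℝ (fun t : ℝ => f (a + t • v)) {t : ℝ | a + t • v ∈ S})
    (ha : f a ≠ 0) (hm : MeasurableSet {x ∈ S | f x = 0}) : μ {x ∈ S | f x = 0} = 0 := by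
  have key : μ ((fun x => a + x) ⁻¹' {x ∈ S | f x = 0}) = 0 := by
    refine measure_eq_zero_of_forall_ray μ (measurable_const_add a hm) fun v => ?_
    set U : Set ℝ := {t : ℝ | a + t • v ∈ S}
    have hUo : IsOpen U := hSo.preimage (by fun_prop)
    have hUc : Convex ℝ U := by
      have : U = (AffineMap.lineMap a (a + v) : ℝ →ᵃ[ℝ] E) ⁻¹' S := by
        ext t; simp [U, AffineMap.lineMap_apply, add_comm]
      rw [this]
      exact hS.affine_preimage _
    have h0 : (0 : ℝ) ∈ U := by simpa [U] using haS
    -- Identity theorem on the interval `U`: vanishing identically is excluded at t = 0, and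
    -- otherwise the zeros are discrete, hence null.
    rcases (hf v).eqOn_zero_or_eventually_ne_zero_of_preconnected hUc.isPreconnected with h | h
    · exact absurd (by simpa using h h0) ha
    · have : ∀ᵐ t ∂(volume.restrict U), f (a + t • v) ≠ 0 :=
        ae_restrict_le_codiscreteWithin hUo.measurableSet h
      rw [ae_restrict_iff' hUo.measurableSet] at this
      refine measure_mono_null ?_ (ae_iff.1 this)
      rintro t ⟨-, ht, ht0⟩
      simp only [Set.mem_ofPred_eq, Classical.not_imp]
      exact ⟨ht, by simpa using ht0⟩
  rwa [measure_preimage_add] at key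

end Radial

/-! ### Integrals depending holomorphically on a parameter. -/

/-- Differentiation under the integral sign for a locally dominated family of holomorphic
functions. -/
theorem hasDerivAt_integral_of_differentiableOn {α : Type*} [MeasurableSpace α] {μ : Measure α}
    {F : ℂ → α → ℂ} {U : Set ℂ} (hU : IsOpen U)
    (hm : ∀ t ∈ U, AEStronglyMeasurable (F t) μ)
    (hd : ∀ y, DifferentiableOn ℂ (fun t => F t y) U) {b : α → ℝ} (hb : Integrable b μ)
    (hFb : ∀ t ∈ U, ∀ y, ‖F t y‖ ≤ b y) {t₀ : ℂ} (ht : t₀ ∈ U) :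
    HasDerivAt (fun t => ∫ y, F t y ∂μ) (∫ y, deriv (fun t => F t y) t₀ ∂μ) t₀ := by
  obtain ⟨ε, hε, hεU⟩ := Metric.isOpen_iff.1 hU t₀ ht
  have hsub : ∀ t ∈ Metric.ball t₀ (ε / 2), Metric.closedBall t (ε / 4) ⊆ U := by
    intro t ht s hs
    apply hεU
    rw [Metric.mem_ball] at ht ⊢
    rw [Metric.mem_closedBall] at hs
    linarith [dist_triangle s t t₀]
  refine (hasDerivAt_integral_of_dominated_loc_of_deriv_le (s := Metric.ball t₀ (ε / 2))
    (F' := fun t y => deriv (fun t => F t y) t) (bound := fun y => b y / (ε / 4))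
    (Metric.ball_mem_nhds _ (by positivity)) ?_ ?_ ?_ ?_ (hb.div_const _) ?_).2
  · filter_upwards [hU.mem_nhds ht] with t ht using hm t ht
  · exact hb.mono' (hm _ ht) (Filter.Eventually.of_forall (hFb _ ht))
  -- The derivative is measurable in y as a limit of difference quotients along a sequence.
  · have hlim : Filter.Tendsto (fun k : ℕ => t₀ + ((ε / 2 / (k + 1) : ℝ) : ℂ)) Filter.atTop
        (𝓝[≠] t₀) := by
      refine tendsto_nhdsWithin_iff.2 ⟨?_, Filter.Eventually.of_forall fun k => ?_⟩
      · have : Filter.Tendsto (fun k : ℕ => ε / 2 / ((k : ℝ) + 1)) Filter.atTop (𝓝 0) :=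
          by
          simpa [div_eq_mul_inv] using
            (tendsto_one_div_add_atTop_nhds_zero_nat (𝕜 := ℝ)).const_mul (ε / 2)
        have h2 := (Complex.continuous_ofReal.tendsto 0).comp this
        simpa using h2.const_add t₀
      · have : ((ε / 2 / (k + 1) : ℝ) : ℂ) ≠ 0 := by
          exact_mod_cast (by positivity : (ε / 2 / ((k : ℝ) + 1)) ≠ 0)
        simpa using this
    refine aestronglyMeasurable_of_tendsto_ae Filter.atTop
      (f := fun (k : ℕ) y => slope (fun t => F t y) t₀ (t₀ + ((ε / 2 / (k + 1) : ℝ) : ℂ))) ?_ ?_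
    · intro k
      simp only [slope_def_field]
      refine AEStronglyMeasurable.mul_const ((hm _ (hεU ?_)).sub (hm _ ht)) _
      rw [Metric.mem_ball, dist_eq_norm, add_sub_cancel_left, Complex.norm_real,
        Real.norm_of_nonneg (by positivity)]
      have : ε / 2 / ((k : ℝ) + 1) ≤ ε / 2 :=
        div_le_self (by positivity) (by linarith [(Nat.cast_nonneg k : (0 : ℝ) ≤ k)])
      linarith
    · filter_upwards with y
      exact (hasDerivAt_iff_tendsto_slope.1
        ((hd y).differentiableAt (hU.mem_nhds ht)).hasDerivAt).comp hlim
  -- Cauchy's estimate on a circle of radius ε / 4, which stays inside `U`, bounds the derivative by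
  -- b / (ε / 4).
  · filter_upwards with y t ht
    refine Complex.norm_deriv_le_of_forall_mem_sphere_norm_le (by positivity) ?_ fun z hz =>
      hFb z (hsub t ht (Metric.sphere_subset_closedBall hz)) y
    refine (DifferentiableOn.diffContOnCl ?_)
    rw [closure_ball _ (by positivity)]
    exact (hd y).mono (hsub t ht)
  · filter_upwards with y t ht
    exact ((hd y).differentiableAt (hU.mem_nhds (hsub t ht
      (Metric.mem_closedBall_self (by positivity))))).hasDerivAt

/-- Moments of the Gaussian are finite. -/
theorem integrable_norm_pow_mul_exp {E : Type*} [NormedAddCommGroup E] [NormedSpace ℝ E]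
    [MeasurableSpace E] [BorelSpace E] [FiniteDimensional ℝ E] [Nontrivial E] (μ : Measure E)
    [μ.IsAddHaarMeasure] (k : ℕ) {c : ℝ} (hc : 0 < c) :
    Integrable (fun x : E => ‖x‖ ^ k * Real.exp (-c * ‖x‖ ^ 2)) μ := by
  rw [integrable_fun_norm_addHaar μ (f := fun r => r ^ k * Real.exp (-c * r ^ 2))]
  have := integrableOn_rpow_mul_exp_neg_mul_sq hc
    (s := ((Module.finrank ℝ E - 1 + k : ℕ) : ℝ)) (by
      have : (0 : ℝ) ≤ ((Module.finrank ℝ E - 1 + k : ℕ) : ℝ) := Nat.cast_nonneg _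
      linarith)
  refine this.congr_fun (fun x _ => ?_) measurableSet_Ioi
  simp only [Real.rpow_natCast, smul_eq_mul, pow_add]
  ring

/-! ### Harmonic powers of isotropic linear forms. -/

section IsotropicPowers

open MvPolynomial

variable {n : ℕ}

/-- The real and imaginary parts of the polynomial `(∑ᵢ (pᵢ + i qᵢ) Xᵢ) ^ m`. -/
noncomputable def isotropicPow (p q : Fin n → ℝ) :
    ℕ → MvPolynomial (Fin n) ℝ × MvPolynomial (Fin n) ℝ
  | 0 => (1, 0)
  | m + 1 =>
    ((∑ i, C (p i) * X i) * (isotropicPow p q m).1 - (∑ i, C (q i) * X i) * (isotropicPow p q m).2,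
      (∑ i, C (p i) * X i) * (isotropicPow p q m).2 + (∑ i, C (q i) * X i) * (isotropicPow p q m).1)

theorem isotropicPow_succ_fst (p q : Fin n → ℝ) (m : ℕ) : (isotropicPow p q (m + 1)).1 =
    (∑ i, C (p i) * X i) * (isotropicPow p q m).1 -
      (∑ i, C (q i) * X i) * (isotropicPow p q m).2 := rfl

theorem isotropicPow_succ_snd (p q : Fin n → ℝ) (m : ℕ) : (isotropicPow p q (m + 1)).2 =
    (∑ i, C (p i) * X i) * (isotropicPow p q m).2 +
      (∑ i, C (q i) * X i) * (isotropicPow p q m).1 := rfl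

theorem eval_isotropicPow (p q x : Fin n → ℝ) (m : ℕ) :
    ((eval x (isotropicPow p q m).1 : ℝ) : ℂ) + (eval x (isotropicPow p q m).2 : ℝ) * Complex.I =
      (((∑ i, p i * x i : ℝ) : ℂ) + (∑ i, q i * x i : ℝ) * Complex.I) ^ m := by
  induction m with
  | zero => simp [isotropicPow]
  | succ m ih =>
    rw [pow_succ', ← ih]
    simp only [isotropicPow, map_sub, map_add, map_mul, map_sum, eval_C, eval_X]
    push_cast
    linear_combination (-(∑ i, (q i : ℂ) * x i) * (eval x (isotropicPow p q m).2 : ℝ)) *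
      Complex.I_sq

theorem isHomogeneous_sum_C_mul_X (p : Fin n → ℝ) :
    (∑ i, C (p i) * X i : MvPolynomial (Fin n) ℝ).IsHomogeneous 1 :=
  IsHomogeneous.sum _ _ _ fun i _ => by
    simpa using (isHomogeneous_C (Fin n) (p i)).mul (isHomogeneous_X ℝ i)

theorem isHomogeneous_isotropicPow (p q : Fin n → ℝ) (m : ℕ) :
    (isotropicPow p q m).1.IsHomogeneous m ∧ (isotropicPow p q m).2.IsHomogeneous m := by
  induction m with
  | zero => exact ⟨isHomogeneous_one _ _, isHomogeneous_zero _ _ _⟩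
  | succ m ih =>
    have hp := isHomogeneous_sum_C_mul_X p
    have hq := isHomogeneous_sum_C_mul_X q
    rw [add_comm m 1]
    simp only [add_comm 1 m, isotropicPow]
    rw [add_comm m 1]
    exact ⟨(hp.mul ih.1).sub (hq.mul ih.2), (hp.mul ih.2).add (hq.mul ih.1)⟩

theorem pderiv_sum_C_mul_X (p : Fin n → ℝ) (i : Fin n) :
    pderiv i (∑ j, C (p j) * X j : MvPolynomial (Fin n) ℝ) = C (p i) := by
  simp [pderiv_X, Pi.single_apply]

theorem pderiv_isotropicPow (p q : Fin n → ℝ) (i : Fin n) (m : ℕ) :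
    pderiv i (isotropicPow p q (m + 1)).1 =
        C ((m : ℝ) + 1) * (C (p i) * (isotropicPow p q m).1 - C (q i) * (isotropicPow p q m).2) ∧
      pderiv i (isotropicPow p q (m + 1)).2 =
        C ((m : ℝ) + 1) *
          (C (p i) * (isotropicPow p q m).2 + C (q i) * (isotropicPow p q m).1) := by
  induction m with
  | zero =>
    simp only [isotropicPow_succ_fst, isotropicPow_succ_snd, map_sub, map_add,
      Derivation.leibniz, pderiv_sum_C_mul_X]
    simp [isotropicPow]
  | succ m ih =>
    rw [isotropicPow_succ_fst p q (m + 1), isotropicPow_succ_snd p q (m + 1)]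
    simp only [map_sub, map_add, Derivation.leibniz, pderiv_sum_C_mul_X, ih.1, ih.2, smul_eq_mul]
    simp only [isotropicPow_succ_fst, isotropicPow_succ_snd]
    push_cast
    simp only [map_add, map_one]
    constructor <;> ring

/-- The Laplacian of ⟨p + iq, x⟩^m is a multiple of ∑ᵢ (pᵢ + i qᵢ)² = ‖p‖² - ‖q‖² + 2i⟨p, q⟩, which
is zero for an isotropic pair. Real and imaginary parts are kept apart because `sphericalHarmonics`
is a real space. -/
theorem polyLaplacian_isotropicPow {p q : Fin n → ℝ} (hpq : ∑ i, p i * q i = 0)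
    (hn : ∑ i, p i * p i = ∑ i, q i * q i) (m : ℕ) :
    polyLaplacian n (isotropicPow p q m).1 = 0 ∧ polyLaplacian n (isotropicPow p q m).2 = 0 := by
  have hL : ∀ P, polyLaplacian n P = ∑ i, pderiv i (pderiv i P) := fun P => by
    simp [polyLaplacian]
  have hpq' : (∑ i, C (p i) * C (q i) : MvPolynomial (Fin n) ℝ) = 0 := by
    simp_rw [← C_mul, ← map_sum, hpq, map_zero]
  have hn' : (∑ i, (C (p i) * C (p i) - C (q i) * C (q i)) : MvPolynomial (Fin n) ℝ) = 0 := by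
    simp_rw [← C_mul, ← map_sub, ← map_sum, Finset.sum_sub_distrib, hn, sub_self, map_zero]
  rw [hL, hL]
  match m with
  | 0 => simp [isotropicPow]
  | 1 =>
    have h := fun i => pderiv_isotropicPow p q i 0
    simp only [zero_add] at h
    simp only [(h _).1, (h _).2]
    simp [isotropicPow]
  | m + 2 =>
    have h := fun i => pderiv_isotropicPow p q i (m + 1)
    have h' := fun i => pderiv_isotropicPow p q i m
    simp only [(h _).1, (h _).2, Derivation.leibniz, map_sub, map_add, (h' _).1, (h' _).2,
      pderiv_C, add_zero, smul_eq_mul]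
    set P := (isotropicPow p q m).1
    set Q := (isotropicPow p q m).2
    constructor
    · calc _ = ∑ i, ((C (((m + 1 : ℕ) : ℝ)) + C 1) * (C (m : ℝ) + C 1) * P *
              (C (p i) * C (p i) - C (q i) * C (q i)) -
            2 * (C (((m + 1 : ℕ) : ℝ)) + C 1) * (C (m : ℝ) + C 1) * Q * (C (p i) * C (q i))) :=
            Finset.sum_congr rfl fun i _ => by ring
        _ = 0 := by rw [Finset.sum_sub_distrib, ← Finset.mul_sum, ← Finset.mul_sum, hpq', hn']; simp
    · calc _ = ∑ i, ((C (((m + 1 : ℕ) : ℝ)) + C 1) * (C (m : ℝ) + C 1) * Q *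
              (C (p i) * C (p i) - C (q i) * C (q i)) +
            2 * (C (((m + 1 : ℕ) : ℝ)) + C 1) * (C (m : ℝ) + C 1) * P * (C (p i) * C (q i))) :=
            Finset.sum_congr rfl fun i _ => by ring
        _ = 0 := by rw [Finset.sum_add_distrib, ← Finset.mul_sum, ← Finset.mul_sum, hpq', hn']; simp

end IsotropicPowers

/-! ### From the spherical projection to Gaussian coefficients. -/

/-- A function in the kernel of `harmonicProj n m` is orthogonal to `ℋ^n_m`. -/
theorem integral_mul_eq_zero_of_harmonicProj_eq_zero {n m : ℕ} {f : C(UnitSphere n, ℝ)}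
    (hf : harmonicProj n m f = 0) {Y : C(UnitSphere n, ℝ)} (hY : Y ∈ sphericalHarmonics n m) :
    ∫ u, f u * Y u ∂(sphereMeasure n) = 0 := by
  simp only [harmonicProj, LinearMap.comp_apply, LinearEquiv.coe_coe,
    LinearEquiv.map_eq_zero_iff] at hf
  have h1 : sphereToL2 n f ∈ ((sphericalHarmonics n m).map (sphereToL2 n))ᗮ :=
    Submodule.orthogonalProjectionOnto_eq_zero_iff.1 hf
  have h2 := Submodule.inner_right_of_mem_orthogonal (Submodule.mem_map_of_mem hY) h1
  have h3 := ContinuousMap.inner_toLp (𝕜 := ℝ) (μ := sphereMeasure n) Y f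
  rw [← h2]
  refine Eq.trans ?_ h3.symm
  simp

/-- The support function of a set. -/
noncomputable def supportFun {E : Type*} [NormedAddCommGroup E] [InnerProductSpace ℝ E]
    (K : Set E) (x : E) : ℝ :=
  sSup ((fun y => inner ℝ x y) '' K)

/-- The integral of `h(x) (⟪p, x⟫ + i ⟪q, x⟫) ^ m` against a Gaussian. -/
noncomputable def gaussCoeff {E : Type*} [NormedAddCommGroup E] [InnerProductSpace ℝ E]
    [MeasureSpace E] (h : E → ℝ) (m : ℕ) (p q : E) : ℂ :=
  ∫ x : E, (h x : ℂ) * ((inner ℝ p x : ℝ) + (inner ℝ q x : ℝ) * Complex.I) ^ m *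
    (Real.exp (-(1 / 2) * ‖x‖ ^ 2) : ℝ)

theorem supportFn_linearImage {n : ℕ} (K : ConvexBody (EuclideanSpace ℝ (Fin n)))
    (A : Matrix (Fin n) (Fin n) ℝ) (u : UnitSphere n) :
    supportFn (linearImage A K) u =
      supportFun (K : Set (EuclideanSpace ℝ (Fin n))) (Matrix.toEuclideanLin A.transpose u.1) := by
  change sSup ((fun y => inner ℝ u.1 y) '' (Matrix.toEuclideanLin A '' (K : Set _))) = _
  rw [Set.image_image, supportFun]
  congr 1
  refine Set.image_congr fun y _ => ?_
  have : A.transpose = A.conjTranspose := by ext i j; simp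
  rw [this, Matrix.toEuclideanLin_conjTranspose_eq_adjoint, LinearMap.adjoint_inner_left]

/-- The integrand is homogeneous of degree m + 1 apart from the radial Gaussian, so polar
coordinates split off the sphere integral as a factor. -/
theorem gaussCoeff_eq_zero_of_sphere {n : ℕ} (hn : n ≠ 0) {h : EuclideanSpace ℝ (Fin n) → ℝ}
    (hh : ∀ r : ℝ, 0 < r → ∀ x, h (r • x) = r * h x) (m : ℕ) (p q : EuclideanSpace ℝ (Fin n))
    (h0 : ∫ u : UnitSphere n, (h u.1 : ℂ) * ((inner ℝ p u.1 : ℝ) +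
      (inner ℝ q u.1 : ℝ) * Complex.I) ^ m ∂(sphereMeasure n) = 0) : gaussCoeff h m p q = 0 := by
  have : NeZero n := ⟨hn⟩
  have := integral_homogeneous_mul_radial (E := EuclideanSpace ℝ (Fin n)) volume
    (fun x => (h x : ℂ) * ((inner ℝ p x : ℝ) + (inner ℝ q x : ℝ) * Complex.I) ^ m) (m + 1)
    (fun r hr x => by
      simp only [hh r hr, inner_smul_right]
      push_cast
      rw [pow_succ (r : ℂ), show ((r : ℂ) * (inner ℝ p x : ℝ) + r * (inner ℝ q x : ℝ) * Complex.I) =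
        r * ((inner ℝ p x : ℝ) + (inner ℝ q x : ℝ) * Complex.I) by ring, mul_pow]
      ring) (fun r => (Real.exp (-(1 / 2) * r ^ 2) : ℝ))
  rw [gaussCoeff, this]
  erw [h0]
  rw [zero_mul]

theorem gaussCoeff_eq_zero_of_harmonicProj_eq_zero {n : ℕ} (hn : n ≠ 0) {m : ℕ}
    {h : EuclideanSpace ℝ (Fin n) → ℝ} (hh : ∀ r : ℝ, 0 < r → ∀ x, h (r • x) = r * h x)
    {f : C(UnitSphere n, ℝ)} (hfh : ∀ u, f u = h u.1) (hf : harmonicProj n m f = 0)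
    {p q : EuclideanSpace ℝ (Fin n)} (hpq : inner ℝ p q = 0) (hn' : ‖p‖ = ‖q‖) :
    gaussCoeff h m p q = 0 := by
  have hin : ∀ x y : EuclideanSpace ℝ (Fin n), inner ℝ x y = ∑ i, x i * y i := fun x y => by
    simp [PiLp.inner_apply, mul_comm]
  have hl := polyLaplacian_isotropicPow (p := p) (q := q) (by rw [← hin, hpq])
    (by rw [← hin, ← hin, real_inner_self_eq_norm_sq, real_inner_self_eq_norm_sq, hn']) m
  have hhom := isHomogeneous_isotropicPow p q m
  have h1 := integral_mul_eq_zero_of_harmonicProj_eq_zero hf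
    (Y := polyRestrict n (isotropicPow p q m).1) (Submodule.mem_map_of_mem ⟨hhom.1, hl.1⟩)
  have h2 := integral_mul_eq_zero_of_harmonicProj_eq_zero hf
    (Y := polyRestrict n (isotropicPow p q m).2) (Submodule.mem_map_of_mem ⟨hhom.2, hl.2⟩)
  refine gaussCoeff_eq_zero_of_sphere hn hh m p q ?_
  have hint : ∀ g : C(UnitSphere n, ℝ),
      Integrable (fun u => ((g u : ℝ) : ℂ)) (sphereMeasure n) := fun g =>
    (Continuous.integrable_of_hasCompactSupport (by fun_prop)
      (HasCompactSupport.of_compactSpace _))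
  calc _ = ∫ u : UnitSphere n, (((f u * polyRestrict n (isotropicPow p q m).1 u : ℝ) : ℂ) +
        (f u * polyRestrict n (isotropicPow p q m).2 u : ℝ) * Complex.I) ∂(sphereMeasure n) := by
        congr 1
        ext u
        rw [hin, hin, ← eval_isotropicPow, hfh]
        simp only [polyRestrict, LinearMap.coe_mk, AddHom.coe_mk, ContinuousMap.coe_mk]
        push_cast
        ring
    _ = 0 := by
        refine (integral_add (hint (f * polyRestrict n (isotropicPow p q m).1))
          ((hint (f * polyRestrict n (isotropicPow p q m).2)).mul_const _)).trans ?_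
        rw [integral_mul_const]
        have e : ∀ g : UnitSphere n → ℝ, ∫ u, g u ∂(sphereMeasure n) = 0 →
            ∫ u, (g u : ℂ) ∂(sphereMeasure n) = 0 := fun g hg => by
          rw [integral_complex_ofReal, hg, Complex.ofReal_zero]
        erw [e _ h1, e _ h2]
        simp

theorem exists_bound_of_homogeneous {E : Type*} [NormedAddCommGroup E] [NormedSpace ℝ E]
    [FiniteDimensional ℝ E] {h : E → ℝ} (hc : Continuous h)
    (hh : ∀ r : ℝ, 0 < r → ∀ x, h (r • x) = r * h x) :
    ∃ R : ℝ, 0 ≤ R ∧ ∀ x, |h x| ≤ R * ‖x‖ := by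
  obtain ⟨R, hR⟩ := (isCompact_sphere (0 : E) 1).exists_bound_of_continuousOn hc.continuousOn
  have h0 : h 0 = 0 := by
    have := hh 2 two_pos 0
    rw [smul_zero] at this
    linarith
  refine ⟨|R|, abs_nonneg _, fun x => ?_⟩
  by_cases hx : x = 0
  · simp [hx, h0]
  · have hx' : 0 < ‖x‖ := norm_pos_iff.2 hx
    have h1 := hh ‖x‖ hx' (‖x‖⁻¹ • x)
    rw [smul_inv_smul₀ hx'.ne'] at h1
    rw [h1, abs_mul, abs_of_pos hx', mul_comm]
    refine mul_le_mul_of_nonneg_right ?_ hx'.le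
    refine le_trans (hR (‖x‖⁻¹ • x) ?_) (le_abs_self R)
    simp [norm_smul, hx'.ne']

theorem integral_comp_linearMap {E F : Type*} [NormedAddCommGroup E] [NormedSpace ℝ E]
    [MeasurableSpace E] [BorelSpace E] [FiniteDimensional ℝ E] (μ : Measure E)
    [μ.IsAddHaarMeasure] [NormedAddCommGroup F] [NormedSpace ℝ F] {L : E →ₗ[ℝ] E}
    (hL : LinearMap.det L ≠ 0) (f : E → F) :
    ∫ y, f (L y) ∂μ = |(LinearMap.det L)⁻¹| • ∫ x, f x ∂μ := by
  have hemb : MeasurableEmbedding L :=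
    (LinearEquiv.ofIsUnitDet (v := Module.finBasis ℝ E) (v' := Module.finBasis ℝ E) (f := L)
      (by simpa using hL)).toContinuousLinearEquiv.toHomeomorph.measurableEmbedding
  rw [← hemb.integral_map, Measure.map_linearMap_addHaar_eq_smul_addHaar μ hL,
    integral_smul_measure, ENNReal.toReal_ofReal (abs_nonneg _)]

theorem norm_inner_add_inner_mul_I_le {E : Type*} [NormedAddCommGroup E]
    [InnerProductSpace ℝ E] (p q x : E) :
    ‖((inner ℝ p x : ℝ) : ℂ) + (inner ℝ q x : ℝ) * Complex.I‖ ≤ (‖p‖ + ‖q‖) * ‖x‖ := by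
  refine (norm_add_le _ _).trans ?_
  rw [norm_mul, Complex.norm_I, mul_one, Complex.norm_real, Complex.norm_real, add_mul]
  exact add_le_add (norm_inner_le_norm _ _) (norm_inner_le_norm _ _)

section GaussCoeff

variable {E : Type*} [NormedAddCommGroup E] [InnerProductSpace ℝ E] [FiniteDimensional ℝ E]
  [MeasurableSpace E] [BorelSpace E]

theorem gaussCoeff_comp_isometry (h : E → ℝ) (m : ℕ) (p q : E) (R : E ≃ₗᵢ[ℝ] E) :
    gaussCoeff (fun x => h (R x)) m p q = gaussCoeff h m (R p) (R q) := by
  refine Eq.trans ?_ (R.measurePreserving.integral_comp R.toHomeomorph.measurableEmbedding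
    fun x => (h x : ℂ) * ((inner ℝ (R p) x : ℝ) + (inner ℝ (R q) x : ℝ) * Complex.I) ^ m *
      (Real.exp (-(1 / 2) * ‖x‖ ^ 2) : ℝ))
  simp [gaussCoeff]

/-- Dominated convergence. `T` may be singular, which later carries the vanishing over to maps of
rank two. -/
theorem continuous_gaussCoeff_comp [Nontrivial E] {F : Type*} [NormedAddCommGroup F]
    [NormedSpace ℝ F] [FiniteDimensional ℝ F] {h : F → ℝ} (hc : Continuous h)
    (hh : ∀ r : ℝ, 0 < r → ∀ x, h (r • x) = r * h x) (m : ℕ) (p q : E) :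
    Continuous fun T : E →L[ℝ] F => gaussCoeff (fun x => h (T x)) m p q := by
  obtain ⟨R, hR0, hR⟩ := exists_bound_of_homogeneous hc hh
  rw [continuous_iff_continuousAt]
  intro T₀
  refine continuousAt_of_dominated (bound := fun x => R * (‖T₀‖ + 1) * (‖p‖ + ‖q‖) ^ m *
    (‖x‖ ^ (m + 1) * Real.exp (-(1 / 2) * ‖x‖ ^ 2))) ?_ ?_ ?_ ?_
  · filter_upwards with T
    exact (by fun_prop : Continuous _).aestronglyMeasurable
  · filter_upwards [Metric.ball_mem_nhds T₀ one_pos] with T hT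
    filter_upwards with x
    have hT' : ‖T‖ ≤ ‖T₀‖ + 1 := by
      have := norm_le_norm_add_norm_sub' T T₀
      rw [Metric.mem_ball, dist_eq_norm] at hT
      linarith
    rw [norm_mul, norm_mul, norm_pow, Complex.norm_real, Complex.norm_real,
      Real.norm_of_nonneg (Real.exp_pos _).le, Real.norm_eq_abs]
    calc |h (T x)| * ‖((inner ℝ p x : ℝ) : ℂ) + (inner ℝ q x : ℝ) * Complex.I‖ ^ m *
          Real.exp (-(1 / 2) * ‖x‖ ^ 2)
        ≤ (R * ((‖T₀‖ + 1) * ‖x‖)) * ((‖p‖ + ‖q‖) * ‖x‖) ^ m * Real.exp (-(1 / 2) * ‖x‖ ^ 2) := by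
          gcongr
          · refine (hR _).trans ?_
            gcongr
            refine (T.le_opNorm x).trans ?_
            gcongr
          · exact norm_inner_add_inner_mul_I_le p q x
      _ = _ := by rw [mul_pow]; ring
  · exact (integrable_norm_pow_mul_exp _ _ (by norm_num)).const_mul _
  · filter_upwards with x
    exact (by fun_prop : Continuous _).continuousAt

end GaussCoeff

/-! ### Analytic dependence of the coefficients on the matrix. -/

section Analytic

open Matrix

variable {n : ℕ}

theorem differentiable_det_of_entries {k : ℕ} {M : ℂ → Matrix (Fin k) (Fin k) ℂ}
    (hM : ∀ i j, Differentiable ℂ fun t => M t i j) : Differentiable ℂ fun t => (M t).det := by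
  simp only [Matrix.det_apply]
  refine Differentiable.fun_sum fun σ _ => ?_
  refine Differentiable.const_smul ?_ _
  exact Differentiable.fun_finsetProd fun i _ => hM _ _

theorem differentiable_adjugate_of_entries {M : ℂ → Matrix (Fin n) (Fin n) ℂ}
    (hM : ∀ i j, Differentiable ℂ fun t => M t i j) (i j : Fin n) :
    Differentiable ℂ fun t => (M t).adjugate i j := by
  simp only [Matrix.adjugate_apply]
  refine differentiable_det_of_entries fun k l => ?_
  simp only [Matrix.updateRow_apply]
  split_ifs
  · exact differentiable_const _
  · exact hM _ _

/-- The integrand of `gaussCoeff`, with `x` replaced by `N y` for a complex matrix `N`. -/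
noncomputable def gaussIntegrand (h : EuclideanSpace ℝ (Fin n) → ℝ) (m : ℕ)
    (p q : EuclideanSpace ℝ (Fin n)) (N : Matrix (Fin n) (Fin n) ℂ)
    (y : EuclideanSpace ℝ (Fin n)) : ℂ :=
  (h y : ℂ) * (∑ i, ((p i : ℂ) + q i * Complex.I) * (N *ᵥ fun j => (y j : ℂ)) i) ^ m *
    Complex.exp (-(1 / 2) * ∑ i, (N *ᵥ fun j => (y j : ℂ)) i ^ 2)

/-- At the real invertible matrix `D` the form ∑ᵢ (Dy)ᵢ² is positive definite. By compactness of the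
unit sphere its real part stays above c‖y‖² for complex t near t₀, so a fixed Gaussian dominates the
holomorphic integrands. -/
theorem analyticAt_integral_gaussIntegrand (hn : n ≠ 0) {h : EuclideanSpace ℝ (Fin n) → ℝ}
    (hc : Continuous h) (hh : ∀ r : ℝ, 0 < r → ∀ x, h (r • x) = r * h x) (m : ℕ)
    (p q : EuclideanSpace ℝ (Fin n)) {N : ℂ → Matrix (Fin n) (Fin n) ℂ}
    (hN : ∀ i j, Differentiable ℂ fun t => N t i j) {t₀ : ℂ} {D : Matrix (Fin n) (Fin n) ℝ}
    (hD : N t₀ = D.map (fun x : ℝ => (x : ℂ))) (hdet : D.det ≠ 0) :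
    AnalyticAt ℂ (fun t => ∫ y, gaussIntegrand h m p q (N t) y) t₀ := by
  have : NeZero n := ⟨hn⟩
  obtain ⟨R, hR0, hR⟩ := exists_bound_of_homogeneous hc hh
  set w : ℂ → EuclideanSpace ℝ (Fin n) → Fin n → ℂ := fun t y => N t *ᵥ fun j => (y j : ℂ)
  have hNc : ∀ i j, Continuous fun t => N t i j := fun i j => (hN i j).continuous
  have hwc : ∀ i, Continuous fun z : ℂ × EuclideanSpace ℝ (Fin n) => w z.1 z.2 i := fun i => by
    simp only [w, Matrix.mulVec, dotProduct]
    refine continuous_finsetSum _ fun j _ => ?_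
    exact ((hNc i j).comp continuous_fst).mul (by fun_prop)
  have hws : ∀ t (r : ℝ) y, w t (r • y) = (r : ℂ) • w t y := fun t r y => by
    simp only [w, ← Matrix.mulVec_smul]
    congr 1
    ext j
    simp
  set Q : ℂ × EuclideanSpace ℝ (Fin n) → ℝ := fun z => (∑ i, w z.1 z.2 i ^ 2).re
  set L : ℂ × EuclideanSpace ℝ (Fin n) → ℝ := fun z =>
    ‖∑ i, ((p i : ℂ) + q i * Complex.I) * w z.1 z.2 i‖
  have hQc : Continuous Q := by fun_prop
  have hLc : Continuous L := by fun_prop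
  have hpos : ∀ y ∈ Metric.sphere (0 : EuclideanSpace ℝ (Fin n)) 1, 0 < Q (t₀, y) := by
    intro y hy
    have hw0 : ∀ i, w t₀ y i = ((D *ᵥ fun j => y j) i : ℝ) := fun i => by
      simp [w, hD, Matrix.mulVec, dotProduct]
    have : Q (t₀, y) = ∑ i, (D *ᵥ fun j => y j) i ^ 2 := by
      simp only [Q, hw0]
      rw [← Complex.ofReal_re (∑ i, (D *ᵥ fun j => y j) i ^ 2)]
      push_cast
      rfl
    rw [this]
    refine lt_of_le_of_ne (Finset.sum_nonneg fun i _ => sq_nonneg _) fun h0 => ?_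
    rw [eq_comm, Finset.sum_eq_zero_iff_of_nonneg fun i _ => sq_nonneg _] at h0
    have hz : (D *ᵥ fun j => y j) = 0 := by
      ext i
      simpa using h0 i (Finset.mem_univ i)
    have hy0 := Matrix.eq_zero_of_mulVec_eq_zero hdet hz
    have : y = 0 := by ext j; exact congrFun hy0 j
    simp [this] at hy
  obtain ⟨y₀, hy₀, hmin⟩ := (isCompact_sphere (0 : EuclideanSpace ℝ (Fin n)) 1).exists_isMinOn
    (NormedSpace.sphere_nonempty.2 zero_le_one) (f := fun y => Q (t₀, y))
    (by fun_prop)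
  obtain ⟨y₁, hy₁, hmax⟩ := (isCompact_sphere (0 : EuclideanSpace ℝ (Fin n)) 1).exists_isMaxOn
    (NormedSpace.sphere_nonempty.2 zero_le_one) (f := fun y => L (t₀, y))
    (by fun_prop)
  -- Half the minimum and the maximum plus one give strict inequalities at t₀, which persist nearby.
  set c := Q (t₀, y₀) / 2
  set B := L (t₀, y₁) + 1
  have hc0 : 0 < c := half_pos (hpos y₀ hy₀)
  have hB0 : 0 ≤ B := add_nonneg (norm_nonneg _) zero_le_one
  have hev : ∀ᶠ t in 𝓝 t₀, ∀ y ∈ Metric.sphere (0 : EuclideanSpace ℝ (Fin n)) 1,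
      c < Q (t, y) ∧ L (t, y) < B := by
    refine (isCompact_sphere _ _).eventually_forall_of_forall_eventually fun y hy => ?_
    refine (hQc.continuousAt.eventually_const_lt ?_).and (hLc.continuousAt.eventually_lt_const ?_)
    · have := hmin hy
      simp only [Set.mem_ofPred_eq] at this
      have := hpos y₀ hy₀
      simp only [c]
      linarith
    · have := hmax hy
      simp only [Set.mem_ofPred_eq] at this
      simp only [B]
      linarith
  obtain ⟨U, hUs, hUo, htU⟩ := mem_nhds_iff.1 hev
  have hbound : ∀ t ∈ U, ∀ y, c * ‖y‖ ^ 2 ≤ Q (t, y) ∧ L (t, y) ≤ B * ‖y‖ := by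
    intro t ht y
    by_cases hy : y = 0
    · have : w t 0 = 0 := by simpa using hws t 0 0
      simp [hy, Q, L, this]
    · have hy' : 0 < ‖y‖ := norm_pos_iff.2 hy
      obtain ⟨h1, h2⟩ := hUs ht (‖y‖⁻¹ • y) (by simp [norm_smul, hy'.ne'])
      have hyy : w t y = (‖y‖ : ℂ) • w t (‖y‖⁻¹ • y) := by
        rw [← hws, smul_inv_smul₀ hy'.ne']
      have hQ : Q (t, y) = ‖y‖ ^ 2 * Q (t, ‖y‖⁻¹ • y) := by
        simp only [Q]
        rw [hyy]
        simp only [Pi.smul_apply, smul_eq_mul, mul_pow, ← Finset.mul_sum]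
        rw [← Complex.ofReal_pow, Complex.re_ofReal_mul]
      have hL : L (t, y) = ‖y‖ * L (t, ‖y‖⁻¹ • y) := by
        simp only [L]
        rw [hyy]
        simp only [Pi.smul_apply, smul_eq_mul, mul_left_comm _ (‖y‖ : ℂ), ← Finset.mul_sum]
        rw [norm_mul, Complex.norm_real, norm_norm]
      rw [hQ, hL, mul_comm c, mul_comm B]
      exact ⟨mul_le_mul_of_nonneg_left h1.le (by positivity),
        mul_le_mul_of_nonneg_left h2.le (by positivity)⟩
  refine DifferentiableOn.analyticAt (s := U) ?_ (hUo.mem_nhds htU)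
  intro t ht
  refine (hasDerivAt_integral_of_differentiableOn (F := fun t y => gaussIntegrand h m p q (N t) y)
    hUo (fun s _ => ?_) (fun y => ?_)
    (b := fun y => R * B ^ m * (‖y‖ ^ (m + 1) * Real.exp (-(c / 2) * ‖y‖ ^ 2)))
    ((integrable_norm_pow_mul_exp _ _ (by positivity)).const_mul _) ?_
    ht).differentiableAt.differentiableWithinAt
  · have hws' : ∀ i, Continuous fun y => (N s *ᵥ fun j => ((y : EuclideanSpace ℝ (Fin n)) j : ℂ)) i :=
      fun i => (hwc i).comp (Continuous.prodMk_right s)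
    unfold gaussIntegrand
    exact (by fun_prop : Continuous _).aestronglyMeasurable
  · have : ∀ i, Differentiable ℂ fun t => (N t *ᵥ fun j => (y j : ℂ)) i := fun i => by
      simp only [Matrix.mulVec, dotProduct]
      exact Differentiable.fun_sum fun j _ => (hN i j).mul_const _
    unfold gaussIntegrand
    exact (by fun_prop : Differentiable ℂ _).differentiableOn
  · intro s hs y
    obtain ⟨h1, h2⟩ := hbound s hs y
    rw [gaussIntegrand, norm_mul, norm_mul, norm_pow, Complex.norm_real, Complex.norm_exp]
    calc _ ≤ (R * ‖y‖) * (B * ‖y‖) ^ m * Real.exp (-(c / 2) * ‖y‖ ^ 2) := by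
          gcongr
          · exact hR y
          · have : (-(1 / 2) * ∑ i, (N s *ᵥ fun j => (y j : ℂ)) i ^ 2).re = -(1 / 2) * Q (s, y) := by
              rw [show (-(1 / 2) : ℂ) = ((-(1 / 2) : ℝ) : ℂ) by push_cast; ring,
                Complex.re_ofReal_mul]
            rw [this]
            linarith
      _ = _ := by rw [mul_pow]; ring

/-- Up to a non-zero factor, this is the transpose of the inverse of `A`. -/
noncomputable def cofactorMul {R : Type*} [CommRing R] (A : Matrix (Fin n) (Fin n) R) :
    Matrix (Fin n) (Fin n) R :=
  A.det • A.adjugateᵀ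

theorem transpose_mul_cofactorMul {R : Type*} [CommRing R] (A : Matrix (Fin n) (Fin n) R) :
    Aᵀ * cofactorMul A = A.det ^ 2 • 1 := by
  rw [cofactorMul, Matrix.mul_smul, ← Matrix.transpose_mul, Matrix.adjugate_mul,
    Matrix.transpose_smul, Matrix.transpose_one, smul_smul, sq]

theorem det_cofactorMul_ne_zero {A : Matrix (Fin n) (Fin n) ℝ} (hA : A.det ≠ 0) :
    (cofactorMul A).det ≠ 0 := by
  have := congrArg Matrix.det (transpose_mul_cofactorMul A)
  rw [Matrix.det_mul, Matrix.det_smul, Matrix.det_one, mul_one] at this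
  intro h0
  rw [h0, mul_zero] at this
  exact pow_ne_zero _ (pow_ne_zero 2 hA) this.symm

/-- Substitute x = Dy with D = `cofactorMul A`. Then AᵀDy = (det A)² y, and since the factor is
positive, positive homogeneity extracts it from h. Using D instead of the inverse of Aᵀ keeps the
entries polynomial in A, so they extend to complex arguments. -/
theorem gaussCoeff_comp_transpose_eq {h : EuclideanSpace ℝ (Fin n) → ℝ}
    (hh : ∀ r : ℝ, 0 < r → ∀ x, h (r • x) = r * h x) (m : ℕ) (p q : EuclideanSpace ℝ (Fin n))
    {A : Matrix (Fin n) (Fin n) ℝ} (hA : A.det ≠ 0) :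
    ∃ c : ℝ, c ≠ 0 ∧ gaussCoeff (fun x => h (toEuclideanLin Aᵀ x)) m p q =
      c * ∫ y, gaussIntegrand h m p q ((cofactorMul A).map fun x : ℝ => (x : ℂ)) y := by
  set D := cofactorMul A with hDdef
  have hD : LinearMap.det (toEuclideanLin D) ≠ 0 := by
    change LinearMap.det (Matrix.toLpLin 2 2 D) ≠ 0
    rw [Matrix.toLpLin_eq_toLin, LinearMap.det_toLin]
    exact det_cofactorMul_ne_zero hA
  have h1 := integral_comp_linearMap volume hD (fun x : EuclideanSpace ℝ (Fin n) =>
    (h (toEuclideanLin Aᵀ x) : ℂ) * ((inner ℝ p x : ℝ) + (inner ℝ q x : ℝ) * Complex.I) ^ m *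
    (Real.exp (-(1 / 2) * ‖x‖ ^ 2) : ℝ))
  refine ⟨|LinearMap.det (toEuclideanLin D)| * A.det ^ 2, by positivity, ?_⟩
  have h2 : ∀ y, (h (toEuclideanLin Aᵀ (toEuclideanLin D y)) : ℂ) *
      ((inner ℝ p (toEuclideanLin D y) : ℝ) +
        (inner ℝ q (toEuclideanLin D y) : ℝ) * Complex.I) ^ m *
      (Real.exp (-(1 / 2) * ‖toEuclideanLin D y‖ ^ 2) : ℝ) =
      (A.det ^ 2 : ℝ) * gaussIntegrand h m p q (D.map fun x : ℝ => (x : ℂ)) y := by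
    intro y
    have e1 : toEuclideanLin Aᵀ (toEuclideanLin D y) = A.det ^ 2 • y := by
      have : toEuclideanLin (Aᵀ * D) y = toEuclideanLin Aᵀ (toEuclideanLin D y) := by
        simp [Matrix.toLpLin_apply, Matrix.mulVec_mulVec]
      rw [← this, hDdef, transpose_mul_cofactorMul]
      simp
    have e2 : ∀ i, ((D.map fun x : ℝ => (x : ℂ)) *ᵥ fun j => (y j : ℂ)) i =
        ((toEuclideanLin D y) i : ℝ) := fun i => by
      simp [Matrix.toLpLin_apply, Matrix.mulVec, dotProduct]
    rw [e1, hh _ (by positivity)]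
    simp only [gaussIntegrand, e2]
    rw [EuclideanSpace.real_norm_sq_eq]
    simp only [PiLp.inner_apply, RCLike.inner_apply, conj_trivial]
    push_cast
    simp only [add_mul, Finset.sum_add_distrib, Finset.sum_mul]
    rw [Finset.sum_congr rfl fun i _ => mul_comm _ (p i : ℂ),
      Finset.sum_congr rfl fun i _ => (by ring : (toEuclideanLin D y i : ℂ) * q i * Complex.I =
        q i * Complex.I * (toEuclideanLin D y i : ℂ))]
    ring
  simp only [h2] at h1
  rw [integral_const_mul] at h1
  have h3 : gaussCoeff (fun x => h (toEuclideanLin Aᵀ x)) m p q =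
      |LinearMap.det (toEuclideanLin D)| • (|(LinearMap.det (toEuclideanLin D))⁻¹| •
        gaussCoeff (fun x => h (toEuclideanLin Aᵀ x)) m p q) := by
    rw [smul_smul, ← abs_mul, mul_inv_cancel₀ hD, abs_one, one_smul]
  rw [h3]
  rw [gaussCoeff, ← h1, Complex.real_smul]
  push_cast
  ring

theorem analyticAt_line_integral_gaussIntegrand (hn : n ≠ 0) {h : EuclideanSpace ℝ (Fin n) → ℝ}
    (hc : Continuous h) (hh : ∀ r : ℝ, 0 < r → ∀ x, h (r • x) = r * h x) (m : ℕ)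
    (p q : EuclideanSpace ℝ (Fin n)) (A C : Matrix (Fin n) (Fin n) ℝ) {t₀ : ℝ}
    (hdet : (A + t₀ • C).det ≠ 0) :
    AnalyticAt ℝ (fun t : ℝ => ∫ y, gaussIntegrand h m p q
      ((cofactorMul (A + t • C)).map fun x : ℝ => (x : ℂ)) y) t₀ := by
  set N : ℂ → Matrix (Fin n) (Fin n) ℂ := fun t =>
    cofactorMul (A.map (fun x : ℝ => (x : ℂ)) + t • C.map (fun x : ℝ => (x : ℂ)))
  have hNr : ∀ t : ℝ, N t = (cofactorMul (A + t • C)).map fun x : ℝ => (x : ℂ) := by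
    intro t
    have e : A.map (fun x : ℝ => (x : ℂ)) + (t : ℂ) • C.map (fun x : ℝ => (x : ℂ)) =
        Complex.ofRealHom.mapMatrix (A + t • C) := by
      ext i j; simp
    simp only [N, cofactorMul]
    rw [e, ← RingHom.map_det, ← RingHom.map_adjugate]
    ext i j
    simp
  have hM : ∀ i j, Differentiable ℂ fun t : ℂ =>
      (A.map (fun x : ℝ => (x : ℂ)) + t • C.map (fun x : ℝ => (x : ℂ))) i j := fun i j => by
    simp only [Matrix.add_apply, Matrix.smul_apply, smul_eq_mul]
    fun_prop
  have hN : ∀ i j, Differentiable ℂ fun t => N t i j := fun i j => by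
    simp only [N, cofactorMul, Matrix.smul_apply, Matrix.transpose_apply, smul_eq_mul]
    exact (differentiable_det_of_entries hM).mul (differentiable_adjugate_of_entries hM _ _)
  have key := analyticAt_integral_gaussIntegrand hn hc hh m p q hN (hNr t₀)
    (det_cofactorMul_ne_zero hdet)
  have h2 : AnalyticAt ℝ (fun t : ℝ => ∫ y, gaussIntegrand h m p q (N t) y) t₀ :=
    (key.restrictScalars (𝕜 := ℝ)).comp (Complex.ofRealCLM.analyticAt t₀)
  simpa only [hNr] using h2

end Analytic

/-! ### Almost no matrix or every matrix. -/

section Generic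

open Matrix

variable {n : ℕ}

open scoped MatrixOrder in
/-- Polar decomposition of an invertible matrix. -/
theorem exists_orthogonal_mul_posDef {A : Matrix (Fin n) (Fin n) ℝ} (hA : A.det ≠ 0) :
    ∃ R : Matrix (Fin n) (Fin n) ℝ, R * Rᵀ = 1 ∧ (R * A).PosDef := by
  have hM : (Aᴴ * A).PosSemidef := posSemidef_conjTranspose_mul_self A
  set S := CFC.sqrt (Aᴴ * A)
  have hSS : S * S = Aᴴ * A := CFC.sqrt_mul_sqrt_self _ hM.nonneg
  have hS : S.PosSemidef := (CFC.sqrt_nonneg (Aᴴ * A)).posSemidef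
  have hSt : Sᵀ = S := by
    have := hS.1.eq
    rwa [conjTranspose_eq_transpose_of_trivial] at this
  have hdet : S.det ≠ 0 := by
    have := congrArg Matrix.det hSS
    rw [det_mul, det_mul, conjTranspose_eq_transpose_of_trivial, det_transpose] at this
    intro h0
    rw [h0, mul_zero] at this
    exact mul_ne_zero hA hA this.symm
  rw [conjTranspose_eq_transpose_of_trivial] at hSS
  have hAu : IsUnit A.det := hA.isUnit
  have hSu : IsUnit S.det := hdet.isUnit
  refine ⟨S * A⁻¹, ?_, ?_⟩
  · have h1 : A⁻¹ * (A⁻¹)ᵀ = S⁻¹ * S⁻¹ := by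
      rw [transpose_nonsing_inv, ← Matrix.mul_inv_rev, ← Matrix.mul_inv_rev, hSS]
    calc S * A⁻¹ * (S * A⁻¹)ᵀ = S * (A⁻¹ * (A⁻¹)ᵀ) * S := by
          rw [transpose_mul, hSt]; simp only [Matrix.mul_assoc]
      _ = 1 := by
          rw [h1, ← Matrix.mul_assoc, Matrix.mul_nonsing_inv _ hSu, Matrix.one_mul,
            Matrix.nonsing_inv_mul _ hSu]
  · rw [Matrix.mul_assoc, Matrix.nonsing_inv_mul _ hAu, Matrix.mul_one]
    exact hS.posDef_iff_det_ne_zero.2 hdet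

/-- All Gaussian coefficients of order `m` of `h ∘ Aᵀ` with respect to isotropic pairs vanish. -/
def CoeffsVanish (h : EuclideanSpace ℝ (Fin n) → ℝ) (m : ℕ) (A : Matrix (Fin n) (Fin n) ℝ) :
    Prop :=
  ∀ p q : EuclideanSpace ℝ (Fin n), inner ℝ p q = 0 → ‖p‖ = ‖q‖ →
    gaussCoeff (fun x => h (toEuclideanLin Aᵀ x)) m p q = 0

variable {h : EuclideanSpace ℝ (Fin n) → ℝ}

theorem toEuclideanLin_mul_apply (A B : Matrix (Fin n) (Fin n) ℝ) (x : EuclideanSpace ℝ (Fin n)) :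
    toEuclideanLin (A * B) x = toEuclideanLin A (toEuclideanLin B x) := by
  simp [Matrix.toLpLin_apply, Matrix.mulVec_mulVec]

/-- Since (RA)ᵀ = AᵀRᵀ, rotation invariance of the Gaussian moves Rᵀ onto the pair (p, q), which
stays isotropic. -/
theorem CoeffsVanish.orthogonal_mul {m : ℕ} {A R : Matrix (Fin n) (Fin n) ℝ}
    (hA : CoeffsVanish h m A) (hR : R * Rᵀ = 1) : CoeffsVanish h m (R * A) := by
  intro p q hpq hn
  have hin : ∀ x y : EuclideanSpace ℝ (Fin n),
      inner ℝ (toEuclideanLin Rᵀ x) (toEuclideanLin Rᵀ y) = inner ℝ x y := fun x y => by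
    rw [← conjTranspose_eq_transpose_of_trivial, Matrix.toEuclideanLin_conjTranspose_eq_adjoint,
      LinearMap.adjoint_inner_left, ← Matrix.toEuclideanLin_conjTranspose_eq_adjoint,
      conjTranspose_eq_transpose_of_trivial, ← toEuclideanLin_mul_apply, hR]
    simp
  set ρ : EuclideanSpace ℝ (Fin n) ≃ₗᵢ[ℝ] EuclideanSpace ℝ (Fin n) :=
    (LinearMap.isometryOfInner (toEuclideanLin Rᵀ) hin).toLinearIsometryEquiv rfl
  have hρ : ∀ x, ρ x = toEuclideanLin Rᵀ x := fun x => rfl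
  simp only [transpose_mul, toEuclideanLin_mul_apply, ← hρ]
  rw [gaussCoeff_comp_isometry (fun x => h (toEuclideanLin Aᵀ x)) m p q ρ]
  exact hA _ _ (by rw [ρ.inner_map_map, hpq]) (by rw [ρ.norm_map, ρ.norm_map, hn])

/-- The linear map that sends `a` to the endomorphism with matrix `aᵀ`. -/
noncomputable def transposeToLin :
    (Fin n → Fin n → ℝ) →ₗ[ℝ] (EuclideanSpace ℝ (Fin n) →ₗ[ℝ] EuclideanSpace ℝ (Fin n)) where
  toFun a := toEuclideanLin (Matrix.of a)ᵀ
  map_add' a b := by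
    ext x i
    simp [Matrix.toLpLin_apply, Matrix.mulVec, dotProduct, Finset.sum_add_distrib, add_mul]
  map_smul' c a := by
    ext x i
    simp [Matrix.toLpLin_apply, Matrix.mulVec, dotProduct, Finset.mul_sum, mul_assoc]

theorem continuous_gaussCoeff_matrix (hn : n ≠ 0) (hc : Continuous h)
    (hh : ∀ r : ℝ, 0 < r → ∀ x, h (r • x) = r * h x) (m : ℕ) (p q : EuclideanSpace ℝ (Fin n)) :
    Continuous fun a : Fin n → Fin n → ℝ =>
      gaussCoeff (fun x => h (toEuclideanLin (Matrix.of a)ᵀ x)) m p q := by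
  have : NeZero n := ⟨hn⟩
  have hT : Continuous fun a => LinearMap.toContinuousLinearMap (transposeToLin (n := n) a) :=
    LinearMap.continuous_of_finiteDimensional
      (LinearMap.toContinuousLinearMap.toLinearMap ∘ₗ transposeToLin)
  have := (continuous_gaussCoeff_comp hc hh m p q).comp hT
  exact this

theorem volume_det_eq_zero : volume {a : Fin n → Fin n → ℝ | (Matrix.of a).det = 0} = 0 := by
  have hcont : Continuous fun a : Fin n → Fin n → ℝ => (Matrix.of a).det :=
    Continuous.matrix_det (by fun_prop)
  have := measure_zeros_eq_zero_of_analytic_on_lines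
    (volume : Measure (Fin n → Fin n → ℝ)) (f := fun a => (((Matrix.of a).det : ℝ) : ℂ))
    (a := Matrix.of.symm 1) (S := Set.univ) convex_univ isOpen_univ
    (Set.mem_univ _) ?_ ?_ ?_
  · simpa using this
  · intro v t _
    have : ∀ i j, AnalyticAt ℝ (fun t : ℝ => (1 : Matrix (Fin n) (Fin n) ℝ) i j + t * v i j) t :=
      fun i j => by fun_prop
    have h2 : AnalyticAt ℝ (fun t : ℝ => (Matrix.of
        (Matrix.of.symm 1 + t • v)).det) t := by
      simp only [Matrix.det_apply']
      refine Finset.analyticAt_fun_sum _ fun σ _ => analyticAt_const.mul ?_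
      exact Finset.analyticAt_fun_prod _ fun i _ => this _ _
    exact (Complex.ofRealCLM.analyticAt _).comp h2
  · simp only [ne_eq, Complex.ofReal_eq_zero]
    simp
  · simp only [Set.mem_univ, true_and, Complex.ofReal_eq_zero]
    exact (isClosed_eq hcont continuous_const).measurableSet

/-- Analytic continuation from a neighbourhood. The invertible matrices are not connected, but
modulo orthogonal left factors only positive definite ones remain, and these form a convex set. -/
theorem coeffsVanish_of_ball (hn : n ≠ 0) (hc : Continuous h)
    (hh : ∀ r : ℝ, 0 < r → ∀ x, h (r • x) = r * h x) {m : ℕ} {a₀ : Fin n → Fin n → ℝ}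
    (hdet : (Matrix.of a₀).det ≠ 0) {W : Set (Fin n → Fin n → ℝ)} (hW : W ∈ 𝓝 a₀)
    (hV : ∀ a ∈ W, CoeffsVanish h m (Matrix.of a)) (A : Matrix (Fin n) (Fin n) ℝ) :
    CoeffsVanish h m A := by
  obtain ⟨R₀, hR₀, hS₀⟩ := exists_orthogonal_mul_posDef hdet
  set S₀ := R₀ * Matrix.of a₀
  have hR₀' : R₀ᵀ * R₀ = 1 := mul_eq_one_comm.1 hR₀
  have hPD : ∀ S : Matrix (Fin n) (Fin n) ℝ, S.PosDef → CoeffsVanish h m S := by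
    intro S hS p q hpq hpn
    -- The segment from S₀ to S consists of positive definite matrices, so the coefficient is
    -- analytic along all of it.
    have hseg : ∀ t ∈ Set.Icc (0 : ℝ) 1, (S₀ + t • (S - S₀)).det ≠ 0 := by
      intro t ht
      have e : S₀ + t • (S - S₀) = (1 - t) • S₀ + t • S := by
        rw [smul_sub, sub_smul, one_smul]; abel
      rw [e]
      rcases eq_or_lt_of_le ht.1 with h0 | h0
      · rw [← h0]; simpa using hS₀.det_pos.ne'
      · exact (PosDef.posSemidef_add (hS₀.posSemidef.smul (sub_nonneg.2 ht.2))
          (hS.smul h0)).det_pos.ne'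
    have han : AnalyticOnNhd ℝ (fun t : ℝ => ∫ y, gaussIntegrand h m p q
        ((cofactorMul (S₀ + t • (S - S₀))).map fun x : ℝ => (x : ℂ)) y) (Set.Icc 0 1) :=
      fun t ht => analyticAt_line_integral_gaussIntegrand hn hc hh m p q _ _ (hseg t ht)
    -- For small t, multiplying by R₀ᵀ brings the segment into `W`; multiplying back by R₀ preserves
    -- the vanishing.
    have hev : (fun t : ℝ => ∫ y, gaussIntegrand h m p q
        ((cofactorMul (S₀ + t • (S - S₀))).map fun x : ℝ => (x : ℂ)) y) =ᶠ[𝓝 0] 0 := by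
      have hcont : Continuous fun t : ℝ => S₀ + t • (S - S₀) := by fun_prop
      have h1 : ∀ᶠ t : ℝ in 𝓝 0, (R₀ᵀ * (S₀ + t • (S - S₀)) : Fin n → Fin n → ℝ) ∈ W := by
        have hcont2 : Continuous fun t : ℝ => R₀ᵀ * (S₀ + t • (S - S₀)) := by fun_prop
        refine hcont2.continuousAt.eventually_mem ?_
        have : R₀ᵀ * (S₀ + (0 : ℝ) • (S - S₀)) = a₀ := by
          rw [zero_smul, add_zero, ← Matrix.mul_assoc, hR₀', Matrix.one_mul]; rfl
        rw [this]
        exact hW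
      have h2 : ∀ᶠ t : ℝ in 𝓝 0, (S₀ + t • (S - S₀)).det ≠ 0 := by
        refine (hcont.matrix_det.continuousAt).eventually_ne ?_
        simpa using hS₀.det_pos.ne'
      filter_upwards [h1, h2] with t ht1 ht2
      have h3 := (hV _ ht1).orthogonal_mul hR₀
      have h4 : R₀ * Matrix.of (R₀ᵀ * (S₀ + t • (S - S₀)) : Fin n → Fin n → ℝ) =
          S₀ + t • (S - S₀) := by
        change R₀ * (R₀ᵀ * (S₀ + t • (S - S₀))) = _
        rw [← Matrix.mul_assoc, hR₀, Matrix.one_mul]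
      rw [h4] at h3
      obtain ⟨c, hc0, hceq⟩ := gaussCoeff_comp_transpose_eq hh m p q ht2
      rw [h3 p q hpq hpn] at hceq
      simpa [hc0] using hceq.symm
    have h0 := han.eqOn_zero_of_preconnected_of_eventuallyEq_zero isPreconnected_Icc
      (Set.left_mem_Icc.2 zero_le_one) hev (Set.right_mem_Icc.2 zero_le_one)
    simp only [one_smul, add_sub_cancel, Pi.zero_apply] at h0
    obtain ⟨c, hc0, hceq⟩ := gaussCoeff_comp_transpose_eq hh m p q hS.det_pos.ne'
    rw [hceq, h0, mul_zero]
  have hinv : ∀ B : Matrix (Fin n) (Fin n) ℝ, B.det ≠ 0 → CoeffsVanish h m B := by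
    intro B hB
    obtain ⟨R, hR, hS⟩ := exists_orthogonal_mul_posDef hB
    have := (hPD _ hS).orthogonal_mul (R := Rᵀ) (by simpa using mul_eq_one_comm.1 hR)
    rwa [← Matrix.mul_assoc, mul_eq_one_comm.1 hR, Matrix.one_mul] at this
  intro p q hpq hpn
  -- Singular matrices are limits of invertible ones.
  have hdense : Dense {a : Fin n → Fin n → ℝ | (Matrix.of a).det ≠ 0} :=
    Measure.dense_of_ae (μ := volume) (ae_iff.2 (by simpa using volume_det_eq_zero))
  have hcl : IsClosed {a : Fin n → Fin n → ℝ |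
      gaussCoeff (fun x => h (toEuclideanLin (Matrix.of a)ᵀ x)) m p q = 0} :=
    isClosed_eq (continuous_gaussCoeff_matrix hn hc hh m p q) continuous_const
  have hsub : closure {a : Fin n → Fin n → ℝ | (Matrix.of a).det ≠ 0} ⊆ _ := hcl.closure_subset_iff.2
    (fun a (ha : (Matrix.of a).det ≠ 0) => hinv _ ha p q hpq hpn)
  rw [hdense.closure_eq] at hsub
  exact hsub (Set.mem_univ (A : Fin n → Fin n → ℝ))

theorem ae_not_coeffsVanish (hn : n ≠ 0) (hc : Continuous h)
    (hh : ∀ r : ℝ, 0 < r → ∀ x, h (r • x) = r * h x) {m : ℕ}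
    (hex : ∃ A, ¬ CoeffsVanish h m A) :
    ∀ᵐ a : Fin n → Fin n → ℝ ∂volume, ¬ CoeffsVanish h m (Matrix.of a) := by
  by_contra hnot
  set Z := {a : Fin n → Fin n → ℝ | CoeffsVanish h m (Matrix.of a) ∧ (Matrix.of a).det ≠ 0}
  have hZ : volume Z ≠ 0 := by
    intro h0
    apply hnot
    have h1 : ∀ᵐ a : Fin n → Fin n → ℝ ∂volume, (Matrix.of a).det ≠ 0 :=
      ae_iff.2 (by simpa using volume_det_eq_zero)
    have h2 : ∀ᵐ a : Fin n → Fin n → ℝ ∂volume, a ∉ Z := ae_iff.2 (by simpa using h0)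
    filter_upwards [h1, h2] with a ha1 ha2 ha3
    exact ha2 ⟨ha3, ha1⟩
  -- A non-null set contains a point all of whose neighbourhoods meet it in positive measure.
  obtain ⟨a₀, ha₀, hpos⟩ := exists_mem_forall_mem_nhdsWithin_pos_measure hZ
  have hcont : Continuous fun a : Fin n → Fin n → ℝ => (Matrix.of a).det :=
    Continuous.matrix_det (by fun_prop)
  obtain ⟨r, hr, hball⟩ := Metric.isOpen_iff.1 (isOpen_ne_fun hcont continuous_const) a₀ ha₀.2
  obtain ⟨A, hA⟩ := hex
  refine hA (coeffsVanish_of_ball hn hc hh ha₀.2 (Metric.ball_mem_nhds a₀ hr) ?_ A)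
  intro a₁ ha₁ p q hpq hpn
  -- A coefficient that is non-zero at a₁ has a null zero set in the ball, yet it vanishes on `Z` ∩
  -- ball, which has positive measure.
  by_contra hne
  set f : (Fin n → Fin n → ℝ) → ℂ := fun a => ∫ y, gaussIntegrand h m p q
    ((cofactorMul (Matrix.of a)).map fun x : ℝ => (x : ℂ)) y
  have hiff : ∀ a ∈ Metric.ball a₀ r, (f a = 0 ↔
      gaussCoeff (fun x => h (toEuclideanLin (Matrix.of a)ᵀ x)) m p q = 0) := by
    intro a ha
    obtain ⟨c, hc0, hceq⟩ := gaussCoeff_comp_transpose_eq hh m p q (hball ha)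
    rw [hceq]
    simp [hc0, f]
  have hnull := measure_zeros_eq_zero_of_analytic_on_lines
    (volume : Measure (Fin n → Fin n → ℝ)) (f := f) (a := a₁) (convex_ball a₀ r)
    Metric.isOpen_ball ha₁
    (fun v t ht => analyticAt_line_integral_gaussIntegrand hn hc hh m p q (Matrix.of a₁)
      (Matrix.of v) (hball ht)) (fun h0 => hne ((hiff _ ha₁).1 h0)) (by
      have : {x | x ∈ Metric.ball a₀ r ∧ f x = 0} = Metric.ball a₀ r ∩
          {a | gaussCoeff (fun x => h (toEuclideanLin (Matrix.of a)ᵀ x)) m p q = 0} := by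
        ext a
        exact and_congr_right fun ha => hiff a ha
      rw [this]
      exact Metric.isOpen_ball.measurableSet.inter
        (isClosed_eq (continuous_gaussCoeff_matrix hn hc hh m p q) continuous_const).measurableSet)
  have hpos' := hpos (Z ∩ Metric.ball a₀ r)
    (Filter.inter_mem self_mem_nhdsWithin
      (mem_nhdsWithin_of_mem_nhds (Metric.ball_mem_nhds a₀ hr)))
  refine hpos'.ne' (measure_mono_null ?_ hnull)
  rintro a ⟨haZ, hab⟩
  exact ⟨hab, (hiff a hab).2 (haZ.1 p q hpq hpn)⟩

end Generic

/-! ### Gaussian and circular coefficients in the plane. -/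

/-- The integral of `g(z) z ^ m` against a Gaussian in the plane. -/
noncomputable def planarCoeff (g : ℂ → ℝ) (m : ℕ) : ℂ :=
  ∫ z : ℂ, (g z : ℂ) * z ^ m * (Real.exp (-(1 / 2) * ‖z‖ ^ 2) : ℝ)

/-- The Gaussian is a product, so the k coordinates on which f does not depend integrate out. -/
theorem integral_planar_projection (k : ℕ) (f : ℂ → ℂ) :
    ∫ x : EuclideanSpace ℝ (Fin (k + 2)), f (x 0 + x 1 * Complex.I) *
        (Real.exp (-(1 / 2) * ‖x‖ ^ 2) : ℝ) =
      (∫ z : ℂ, f z * (Real.exp (-(1 / 2) * ‖z‖ ^ 2) : ℝ)) *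
        ((∫ x : ℝ, Real.exp (-(1 / 2) * x ^ 2)) ^ k : ℝ) := by
  have h1 := (EuclideanSpace.volume_preserving_symm_measurableEquiv_toLp
    (Fin (k + 2))).integral_comp' (fun x : Fin (k + 2) → ℝ => f (x 0 + x 1 * Complex.I) *
      (Real.exp (-(1 / 2) * ∑ i, x i ^ 2) : ℝ))
  have h2 := (volume_preserving_piFinSuccAbove (fun _ : Fin (k + 2) => ℝ) 0).integral_comp'
    (fun z : ℝ × (Fin (k + 1) → ℝ) => f (z.1 + z.2 0 * Complex.I) *
      (Real.exp (-(1 / 2) * (z.1 ^ 2 + ∑ i, z.2 i ^ 2)) : ℝ))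
  have mp3 : MeasurePreserving (MeasurableEquiv.prodCongr (MeasurableEquiv.refl ℝ)
      (MeasurableEquiv.piFinSuccAbove (fun _ : Fin (k + 1) => ℝ) 0)) volume volume :=
    (MeasurePreserving.id (volume : Measure ℝ)).prod
      (volume_preserving_piFinSuccAbove (fun _ : Fin (k + 1) => ℝ) 0)
  have h3 := mp3.integral_comp'
    (fun z : ℝ × (ℝ × (Fin k → ℝ)) => f (z.1 + z.2.1 * Complex.I) *
      (Real.exp (-(1 / 2) * (z.1 ^ 2 + (z.2.1 ^ 2 + ∑ i, z.2.2 i ^ 2))) : ℝ))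
  have h4 := (measurePreserving_prodAssoc (volume : Measure ℝ) (volume : Measure ℝ)
    (volume : Measure (Fin k → ℝ))).integral_comp'
    (fun z : ℝ × (ℝ × (Fin k → ℝ)) => f (z.1 + z.2.1 * Complex.I) *
      (Real.exp (-(1 / 2) * (z.1 ^ 2 + (z.2.1 ^ 2 + ∑ i, z.2.2 i ^ 2))) : ℝ))
  have h5 := Complex.volume_preserving_equiv_real_prod.integral_comp'
    (fun z : ℝ × ℝ => f (z.1 + z.2 * Complex.I) * (Real.exp (-(1 / 2) * (z.1 ^ 2 + z.2 ^ 2)) : ℝ))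
  have h6 := integral_prod_mul (μ := (volume : Measure ℝ).prod (volume : Measure ℝ))
    (ν := (volume : Measure (Fin k → ℝ)))
    (fun z : ℝ × ℝ => f (z.1 + z.2 * Complex.I) * (Real.exp (-(1 / 2) * (z.1 ^ 2 + z.2 ^ 2)) : ℝ))
    (fun c => (((∏ i, Real.exp (-(1 / 2) * c i ^ 2) : ℝ)) : ℂ))
  rw [integral_complex_ofReal, integral_fintype_prod_volume_eq_pow
    (fun x => Real.exp (-(1 / 2) * x ^ 2)), Fintype.card_fin] at h6
  have e5 : ∫ z : ℂ, f z * (Real.exp (-(1 / 2) * ‖z‖ ^ 2) : ℝ) =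
      ∫ z : ℝ × ℝ, f (z.1 + z.2 * Complex.I) *
        (Real.exp (-(1 / 2) * (z.1 ^ 2 + z.2 ^ 2)) : ℝ) := by
    rw [← h5]
    congr 1
    ext z
    rw [Complex.sq_norm, Complex.normSq_apply, ← sq, ← sq]
    simp [Complex.measurableEquivRealProd_apply, Complex.re_add_im]
  rw [e5]
  refine Eq.trans ?_ h6
  have e4 : ∀ z : (ℝ × ℝ) × (Fin k → ℝ), f (z.1.1 + z.1.2 * Complex.I) *
      (Real.exp (-(1 / 2) * (z.1.1 ^ 2 + z.1.2 ^ 2)) : ℝ) *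
        (((∏ i, Real.exp (-(1 / 2) * z.2 i ^ 2) : ℝ)) : ℂ) =
      f (z.1.1 + z.1.2 * Complex.I) *
      (Real.exp (-(1 / 2) * (z.1.1 ^ 2 + (z.1.2 ^ 2 + ∑ i, z.2 i ^ 2))) : ℝ) := fun z => by
    rw [mul_assoc, ← Complex.ofReal_mul, ← Real.exp_sum, ← Real.exp_add, ← Finset.mul_sum]
    ring_nf
  simp only [e4]
  refine Eq.trans ?_ h4.symm
  refine Eq.trans ?_ h3
  refine Eq.trans ?_ (Eq.trans h2 ?_)
  · refine Eq.trans ?_ (Eq.trans h1 ?_)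
    · congr 1
      ext x
      rw [EuclideanSpace.real_norm_sq_eq]
      rfl
    · congr 1
      ext x
      rw [Fin.sum_univ_succ]
      rfl
  · congr 1
    ext x
    rw [Fin.sum_univ_succ]
    rfl

/-- Integration in polar coordinates in the plane of a homogeneous function times a radial one. -/
theorem integral_complex_homogeneous_mul_radial (Φ : ℂ → ℂ) (k : ℕ)
    (hΦ : ∀ r : ℝ, 0 < r → ∀ z, Φ (r * z) = (r : ℂ) ^ k * Φ z) (ρ : ℝ → ℂ) :
    ∫ z, Φ z * ρ ‖z‖ = (∫ r in Set.Ioi (0 : ℝ), (r : ℂ) * ((r : ℂ) ^ k * ρ r)) *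
      ∫ θ in Set.Ioo (-Real.pi) Real.pi, Φ (Complex.exp (θ * Complex.I)) := by
  rw [← Complex.integral_comp_polarCoord_symm, ← setIntegral_prod_mul]
  refine setIntegral_congr_fun polarCoord.open_target.measurableSet ?_
  intro p hp
  have hr : 0 < p.1 := hp.1
  simp only [Complex.polarCoord_symm_apply]
  rw [Complex.ofReal_cos, Complex.ofReal_sin, ← Complex.exp_mul_I, hΦ _ hr, norm_mul,
    Complex.norm_exp_ofReal_mul_I, Complex.norm_real, Real.norm_of_nonneg hr.le, mul_one,
    Complex.real_smul]
  ring

/-- The radial moments of the Gaussian. -/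
noncomputable def radialMoment (s : ℕ) : ℝ :=
  ∫ r in Set.Ioi (0 : ℝ), r ^ s * Real.exp (-(1 / 2) * r ^ 2)

theorem radialMoment_eq (s : ℕ) : radialMoment s =
    (1 / 2 : ℝ) ^ (-((s : ℝ) + 1) / 2) * (1 / 2) * Real.Gamma (((s : ℝ) + 1) / 2) := by
  have := integral_rpow_mul_exp_neg_mul_rpow (p := 2) (q := s) (b := 1 / 2) two_pos
    (by have := (Nat.cast_nonneg s : (0 : ℝ) ≤ s); linarith) (by norm_num)
  rw [← this, radialMoment]
  simp

theorem radialMoment_pos (s : ℕ) : 0 < radialMoment s := by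
  rw [radialMoment_eq]
  have : 0 < Real.Gamma (((s : ℝ) + 1) / 2) := Real.Gamma_pos_of_pos (by positivity)
  positivity

theorem radialMoment_add_two (s : ℕ) : radialMoment (s + 2) = (s + 1) * radialMoment s := by
  rw [radialMoment_eq, radialMoment_eq]
  push_cast
  rw [show ((s : ℝ) + 2 + 1) / 2 = ((s : ℝ) + 1) / 2 + 1 by ring,
    Real.Gamma_add_one (by positivity),
    show -((s : ℝ) + 2 + 1) / 2 = -((s : ℝ) + 1) / 2 + (-1) by ring,
    Real.rpow_add (by norm_num), Real.rpow_neg_one]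
  ring

theorem integrableOn_radialMoment (s : ℕ) : IntegrableOn
    (fun r : ℝ => r ^ s * Real.exp (-(1 / 2) * r ^ 2)) (Set.Ioi 0) := by
  have := integrableOn_rpow_mul_exp_neg_mul_sq (b := 1 / 2) (by norm_num)
    (s := s) (by have := (Nat.cast_nonneg s : (0 : ℝ) ≤ s); linarith)
  simpa using this

/-- The integral of `g(z) z ^ m` over the unit circle. -/
noncomputable def circleCoeff (g : ℂ → ℝ) (m : ℕ) : ℂ :=
  ∫ θ in Set.Ioo (-Real.pi) Real.pi,
    (g (Complex.exp (θ * Complex.I)) : ℂ) * Complex.exp (θ * Complex.I) ^ m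

theorem homogeneous_mul_pow {g : ℂ → ℝ} (hg : ∀ r : ℝ, 0 < r → ∀ z, g (r * z) = r * g z) (m : ℕ)
    (r : ℝ) (hr : 0 < r) (z : ℂ) :
    (g (r * z) : ℂ) * (r * z) ^ m = (r : ℂ) ^ (m + 1) * ((g z : ℂ) * z ^ m) := by
  rw [hg r hr, mul_pow]
  push_cast
  ring

theorem planarCoeff_eq {g : ℂ → ℝ} (hg : ∀ r : ℝ, 0 < r → ∀ z, g (r * z) = r * g z) (m : ℕ) :
    planarCoeff g m = radialMoment (m + 2) * circleCoeff g m := by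
  rw [planarCoeff, integral_complex_homogeneous_mul_radial (fun z => (g z : ℂ) * z ^ m) (m + 1)
    (homogeneous_mul_pow hg m) (fun r => (Real.exp (-(1 / 2) * r ^ 2) : ℝ)), circleCoeff]
  congr 1
  rw [radialMoment, ← integral_complex_ofReal]
  congr 1
  ext r
  push_cast
  ring

theorem circleCoeff_eq_zero_iff {g : ℂ → ℝ} (hg : ∀ r : ℝ, 0 < r → ∀ z, g (r * z) = r * g z)
    (m : ℕ) : circleCoeff g m = 0 ↔ planarCoeff g m = 0 := by
  rw [planarCoeff_eq hg]
  simp [(radialMoment_pos (m + 2)).ne']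

/-- The quartic radial weight that arises when the order is lowered by two. -/
theorem integral_lowering_weight {g : ℂ → ℝ} (hg : ∀ r : ℝ, 0 < r → ∀ z, g (r * z) = r * g z)
    (k : ℕ) : ∫ z : ℂ, (g z : ℂ) * z ^ k * ((((k : ℝ) + 2) * ‖z‖ ^ 2 - 1 / 2 * ‖z‖ ^ 4) *
      Real.exp (-(1 / 2) * ‖z‖ ^ 2) : ℝ) =
    (((k : ℝ) - 1) / 2 * radialMoment (k + 4) : ℝ) * circleCoeff g k := by
  rw [integral_complex_homogeneous_mul_radial (fun z => (g z : ℂ) * z ^ k) (k + 1)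
    (homogeneous_mul_pow hg k) (fun r => ((((k : ℝ) + 2) * r ^ 2 - 1 / 2 * r ^ 4) *
      Real.exp (-(1 / 2) * r ^ 2) : ℝ)), circleCoeff]
  congr 1
  -- The moment of order k + 6 is k + 5 times that of order k + 4, and k + 2 - (k + 5) / 2 = (k - 1)
  -- / 2. This factor vanishes only for k = 1.
  have : (((k : ℝ) - 1) / 2 * radialMoment (k + 4)) =
      ((k : ℝ) + 2) * radialMoment (k + 4) - 1 / 2 * radialMoment (k + 4 + 2) := by
    rw [radialMoment_add_two (k + 4)]
    push_cast
    ring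
  rw [this, radialMoment, radialMoment, ← integral_const_mul, ← integral_const_mul,
    ← integral_sub ((integrableOn_radialMoment _).const_mul _)
      ((integrableOn_radialMoment _).const_mul _), ← integral_complex_ofReal]
  congr 1
  ext r
  push_cast
  ring

/-! ### Raising and lowering the order by two. -/

section Ladder

variable {E : Type*} [NormedAddCommGroup E] [InnerProductSpace ℝ E]

/-- The planar coefficients of order `m` of all compositions of `h` with linear maps `ℂ → E`
vanish. -/
def PlanarVanish (h : E → ℝ) (m : ℕ) : Prop :=
  ∀ L : ℂ →L[ℝ] E, planarCoeff (fun z => h (L z)) m = 0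

/-- The linear map `z ↦ z + β z̄` of the plane. -/
noncomputable def beltrami (β : ℂ) : ℂ →ₗ[ℝ] ℂ :=
  LinearMap.id + β • Complex.conjAe.toLinearMap

theorem beltrami_apply (β z : ℂ) : beltrami β z = z + β * (starRingEnd ℂ) z := rfl

theorem beltrami_injective {β : ℂ} (hβ : ‖β‖ < 1) : Function.Injective (beltrami β) := by
  refine (injective_iff_map_eq_zero _).2 fun z hz => ?_
  rw [beltrami_apply] at hz
  by_contra hz0
  have h1 : ‖z‖ = ‖β‖ * ‖z‖ := by
    have := congrArg norm (eq_neg_of_add_eq_zero_left hz)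
    rwa [norm_neg, norm_mul, RCLike.norm_conj] at this
  have h2 : 0 < ‖z‖ := norm_pos_iff.2 hz0
  nlinarith

variable {h : E → ℝ}

/-- Apply the hypothesis to L ∘ B⁻¹, with B = `beltrami β`, and substitute Bz for z. The parameter β
leaves h, which need not be differentiable, and enters the smooth weight. -/
theorem PlanarVanish.integral_beltrami {m : ℕ} (hV : PlanarVanish h m) (L : ℂ →L[ℝ] E) {β : ℂ}
    (hβ : ‖β‖ < 1) :
    ∫ z : ℂ, (h (L z) : ℂ) * (z + β * (starRingEnd ℂ) z) ^ m *
      (Real.exp (-(1 / 2) * ‖z + β * (starRingEnd ℂ) z‖ ^ 2) : ℝ) = 0 := by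
  set B : ℂ ≃ₗ[ℝ] ℂ := LinearEquiv.ofInjectiveEndo (beltrami β) (beltrami_injective hβ)
  have hB : ∀ z, B z = z + β * (starRingEnd ℂ) z := fun z => rfl
  have h1 := hV (L.comp B.symm.toContinuousLinearEquiv.toContinuousLinearMap)
  have h2 := integral_comp_linearMap (volume : Measure ℂ) (L := B.toLinearMap)
    (LinearEquiv.isUnit_det' B).ne_zero (fun z => (h (L (B.symm z)) : ℂ) * z ^ m *
      (Real.exp (-(1 / 2) * ‖z‖ ^ 2) : ℝ))
  have h3 : ∫ z : ℂ, (h (L (B.symm z)) : ℂ) * z ^ m *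
      (Real.exp (-(1 / 2) * ‖z‖ ^ 2) : ℝ) = 0 := h1
  rw [h3, smul_zero] at h2
  refine Eq.trans (integral_congr_ae (Filter.Eventually.of_forall fun z => ?_)) h2
  have hz : B.symm (z + β * (starRingEnd ℂ) z) = z := B.symm_apply_apply z
  simp only [LinearEquiv.coe_coe, hB, hz]

theorem PlanarVanish.integral_deriv_beltrami {m : ℕ} (hc : Continuous h)
    (hh : ∀ r : ℝ, 0 < r → ∀ x, h (r • x) = r * h x) (hV : PlanarVanish h m) (L : ℂ →L[ℝ] E)
    {ζ : ℂ} (hζ : ‖ζ‖ = 1) :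
    ∫ z : ℂ, (h (L z) : ℂ) * (m * z ^ (m - 1) * (ζ * (starRingEnd ℂ) z) -
      1 / 2 * z ^ m * (ζ * (starRingEnd ℂ) z ^ 2 + (starRingEnd ℂ) ζ * z ^ 2)) *
      (Real.exp (-(1 / 2) * ‖z‖ ^ 2) : ℝ) = 0 := by
  obtain ⟨R, hR0, hR⟩ := exists_bound_of_homogeneous (h := fun z : ℂ => h (L z))
    (hc.comp L.continuous) (fun r hr z => by rw [map_smul, hh r hr])
  -- With β = tζ, the conjugate of z + tζz̄ is written z̄ + tζ̄z. This is correct for real t and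
  -- makes F holomorphic in t.
  set F : ℂ → ℂ → ℂ := fun t z => (h (L z) : ℂ) * (z + t * (ζ * (starRingEnd ℂ) z)) ^ m *
    Complex.exp (-(1 / 2) * ((z + t * (ζ * (starRingEnd ℂ) z)) *
      ((starRingEnd ℂ) z + t * ((starRingEnd ℂ) ζ * z)))) with hF
  have hder : ∀ z t, HasDerivAt (fun t => F t z) ((h (L z) : ℂ) *
      (m * (z + t * (ζ * (starRingEnd ℂ) z)) ^ (m - 1) * (ζ * (starRingEnd ℂ) z)) *
        Complex.exp (-(1 / 2) * ((z + t * (ζ * (starRingEnd ℂ) z)) *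
          ((starRingEnd ℂ) z + t * ((starRingEnd ℂ) ζ * z)))) +
      (h (L z) : ℂ) * (z + t * (ζ * (starRingEnd ℂ) z)) ^ m *
        (Complex.exp (-(1 / 2) * ((z + t * (ζ * (starRingEnd ℂ) z)) *
          ((starRingEnd ℂ) z + t * ((starRingEnd ℂ) ζ * z)))) *
        (-(1 / 2) * ((ζ * (starRingEnd ℂ) z) * ((starRingEnd ℂ) z + t * ((starRingEnd ℂ) ζ * z)) +
          (z + t * (ζ * (starRingEnd ℂ) z)) * ((starRingEnd ℂ) ζ * z))))) t := by
    intro z t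
    have a1 : HasDerivAt (fun t : ℂ => z + t * (ζ * (starRingEnd ℂ) z)) (ζ * (starRingEnd ℂ) z) t := by
      simpa using ((hasDerivAt_id t).mul_const (ζ * (starRingEnd ℂ) z)).const_add z
    have a2 : HasDerivAt (fun t : ℂ => (starRingEnd ℂ) z + t * ((starRingEnd ℂ) ζ * z))
        ((starRingEnd ℂ) ζ * z) t := by
      simpa using ((hasDerivAt_id t).mul_const ((starRingEnd ℂ) ζ * z)).const_add ((starRingEnd ℂ) z)
    exact ((a1.pow m).const_mul _).mul ((a1.mul a2).const_mul _).cexp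
  have hnz : ∀ z : ℂ, ‖ζ * (starRingEnd ℂ) z‖ = ‖z‖ := fun z => by
    rw [norm_mul, hζ, one_mul, RCLike.norm_conj]
  have hnz' : ∀ z : ℂ, ‖(starRingEnd ℂ) ζ * z‖ = ‖z‖ := fun z => by
    rw [norm_mul, RCLike.norm_conj, hζ, one_mul]
  have key := hasDerivAt_integral_of_differentiableOn (μ := (volume : Measure ℂ)) (F := F)
    (U := Metric.ball 0 (1 / 4)) Metric.isOpen_ball
    (fun t _ => (by fun_prop : Continuous (F t)).aestronglyMeasurable)
    (fun z t _ => (hder z t).differentiableAt.differentiableWithinAt)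
    (b := fun z => R * 2 ^ m * (‖z‖ ^ (m + 1) * Real.exp (-(1 / 8) * ‖z‖ ^ 2)))
    ((integrable_norm_pow_mul_exp _ _ (by norm_num)).const_mul _) (by
      intro t ht z
      rw [mem_ball_zero_iff] at ht
      have hb1 : ‖z + t * (ζ * (starRingEnd ℂ) z)‖ ≤ 2 * ‖z‖ := by
        refine (norm_add_le _ _).trans ?_
        rw [norm_mul, hnz]
        nlinarith [norm_nonneg z]
      -- For ‖t‖ < 1/4 the perturbation is at most (2/4 + 1/16)‖z‖² ≤ (3/4)‖z‖²; the factor 1/2 in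
      -- the exponent then gives the constant 1/8 of the bound.
      have hb2 : ‖z‖ ^ 2 / 4 ≤ ((z + t * (ζ * (starRingEnd ℂ) z)) *
          ((starRingEnd ℂ) z + t * ((starRingEnd ℂ) ζ * z))).re := by
        have e : (z + t * (ζ * (starRingEnd ℂ) z)) * ((starRingEnd ℂ) z +
            t * ((starRingEnd ℂ) ζ * z)) = ((‖z‖ ^ 2 : ℝ) : ℂ) +
            (t * ((ζ * (starRingEnd ℂ) z) * (starRingEnd ℂ) z + z * ((starRingEnd ℂ) ζ * z)) +
              t ^ 2 * ((ζ * (starRingEnd ℂ) z) * ((starRingEnd ℂ) ζ * z))) := by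
          push_cast
          rw [← Complex.mul_conj']
          ring
        have e2 : ‖t * ((ζ * (starRingEnd ℂ) z) * (starRingEnd ℂ) z + z * ((starRingEnd ℂ) ζ * z)) +
              t ^ 2 * ((ζ * (starRingEnd ℂ) z) * ((starRingEnd ℂ) ζ * z))‖ ≤
              3 / 4 * ‖z‖ ^ 2 := by
          refine (norm_add_le _ _).trans ?_
          rw [norm_mul, norm_mul, norm_mul, norm_pow, hnz, hnz']
          have e3 : ‖(ζ * (starRingEnd ℂ) z) * (starRingEnd ℂ) z + z * ((starRingEnd ℂ) ζ * z)‖ ≤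
              2 * ‖z‖ ^ 2 := by
            refine (norm_add_le _ _).trans ?_
            rw [norm_mul, norm_mul _ ((starRingEnd ℂ) ζ * z), hnz, hnz', RCLike.norm_conj]
            nlinarith
          have e4 : ‖t‖ ^ 2 ≤ 1 / 16 := by nlinarith [norm_nonneg t]
          calc _ ≤ 1 / 4 * (2 * ‖z‖ ^ 2) + 1 / 16 * (‖z‖ * ‖z‖) := by gcongr
            _ ≤ _ := by nlinarith [sq_nonneg ‖z‖]
        rw [e, Complex.add_re, Complex.ofReal_re]
        have := (abs_le.1 ((Complex.abs_re_le_norm _).trans e2)).1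
        linarith
      rw [hF, norm_mul, norm_mul, norm_pow, Complex.norm_real, Complex.norm_exp]
      calc _ ≤ (R * ‖z‖) * (2 * ‖z‖) ^ m * Real.exp (-(1 / 8) * ‖z‖ ^ 2) := by
            gcongr
            · exact hR z
            · rw [show (-(1 / 2) : ℂ) = ((-(1 / 2) : ℝ) : ℂ) by push_cast; ring,
                Complex.re_ofReal_mul]
              linarith
        _ = _ := by rw [mul_pow]; ring) (t₀ := 0) (Metric.mem_ball_self (by norm_num))
  have hreal := HasDerivAt.comp_ofReal (z := 0) (by simpa using key)
  have hzero : (fun t : ℝ => ∫ z : ℂ, F t z) =ᶠ[𝓝 0] fun _ => 0 := by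
    filter_upwards [Metric.ball_mem_nhds (0 : ℝ) one_pos] with t ht
    have h1 := hV.integral_beltrami L (β := t * ζ) (by
      rw [norm_mul, hζ, mul_one, Complex.norm_real]
      simpa using ht)
    rw [← h1]
    congr 1
    ext z
    simp only [hF]
    rw [Complex.ofReal_exp, mul_assoc (t : ℂ) ζ]
    congr 2
    push_cast
    rw [← Complex.mul_conj']
    simp only [map_add, map_mul, Complex.conj_ofReal, Complex.conj_conj]
  have hD : ∫ z : ℂ, deriv (fun t => F t z) 0 = 0 :=
    hreal.unique ((hasDerivAt_const (0 : ℝ) (0 : ℂ)).congr_of_eventuallyEq hzero)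
  rw [← hD]
  congr 1
  ext z
  rw [(hder z 0).deriv, Complex.ofReal_exp]
  have : ((-(1 / 2) * ‖z‖ ^ 2 : ℝ) : ℂ) = -(1 / 2) * (z * (starRingEnd ℂ) z) := by
    push_cast
    rw [← Complex.mul_conj']
  rw [this]
  simp only [zero_mul, add_zero]
  ring

theorem integrable_ladder_term (hc : Continuous h)
    (hh : ∀ r : ℝ, 0 < r → ∀ x, h (r • x) = r * h x) (L : ℂ →L[ℝ] E) (j l : ℕ) :
    Integrable (fun z : ℂ => (h (L z) : ℂ) * (z ^ j * (starRingEnd ℂ) z ^ l) *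
      (Real.exp (-(1 / 2) * ‖z‖ ^ 2) : ℝ)) := by
  obtain ⟨R, hR0, hR⟩ := exists_bound_of_homogeneous (h := fun z : ℂ => h (L z))
    (hc.comp L.continuous) (fun r hr z => by rw [map_smul, hh r hr])
  refine ((integrable_norm_pow_mul_exp (volume : Measure ℂ) (1 + j + l)
    (c := 1 / 2) (by norm_num)).const_mul R).mono'
    (by fun_prop : Continuous _).aestronglyMeasurable (Filter.Eventually.of_forall fun z => ?_)
  rw [norm_mul, norm_mul, norm_mul, norm_pow, norm_pow, RCLike.norm_conj, Complex.norm_real,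
    Complex.norm_real, Real.norm_of_nonneg (Real.exp_pos _).le]
  calc _ ≤ (R * ‖z‖) * (‖z‖ ^ j * ‖z‖ ^ l) * Real.exp (-(1 / 2) * ‖z‖ ^ 2) := by
        gcongr
        exact hR z
    _ = _ := by ring

/-- The derivative has a part linear in ζ, which lowers the order, and one linear in ζ̄, which
raises it. The choices ζ = 1 and ζ = i separate them. -/
theorem PlanarVanish.raising_lowering {m : ℕ} (hc : Continuous h)
    (hh : ∀ r : ℝ, 0 < r → ∀ x, h (r • x) = r * h x) (hV : PlanarVanish h m) (L : ℂ →L[ℝ] E) :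
    planarCoeff (fun z => h (L z)) (m + 2) = 0 ∧
      ∫ z : ℂ, (h (L z) : ℂ) * (m * z ^ (m - 1) * (starRingEnd ℂ) z -
        1 / 2 * z ^ m * (starRingEnd ℂ) z ^ 2) * (Real.exp (-(1 / 2) * ‖z‖ ^ 2) : ℝ) = 0 := by
  set e : ℂ → ℂ := fun z => (Real.exp (-(1 / 2) * ‖z‖ ^ 2) : ℝ)
  have i1 := (integrable_ladder_term hc hh L (m - 1) 1).const_mul (m : ℂ)
  have i2 := (integrable_ladder_term hc hh L m 2).const_mul (1 / 2 : ℂ)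
  have i3 := (integrable_ladder_term hc hh L (m + 2) 0).const_mul (1 / 2 : ℂ)
  have hA : ∀ ζ : ℂ, ‖ζ‖ = 1 → ζ * ∫ z : ℂ, (h (L z) : ℂ) * (m * z ^ (m - 1) *
      (starRingEnd ℂ) z - 1 / 2 * z ^ m * (starRingEnd ℂ) z ^ 2) * e z =
      (starRingEnd ℂ) ζ * (1 / 2 * planarCoeff (fun z => h (L z)) (m + 2)) := by
    intro ζ hζ
    have h1 := hV.integral_deriv_beltrami hc hh L hζ
    rw [planarCoeff, ← integral_const_mul, ← integral_const_mul, ← integral_const_mul,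
      ← sub_eq_zero, ← integral_sub, ← h1]
    · congr 1
      ext z
      simp only [e]
      ring
    · refine ((i1.sub i2).const_mul ζ).congr (Filter.Eventually.of_forall fun z => ?_)
      simp only [Pi.sub_apply, e]
      ring
    · refine (i3.const_mul ((starRingEnd ℂ) ζ)).congr (Filter.Eventually.of_forall fun z => ?_)
      simp only [pow_zero, mul_one]
  have h1 := hA 1 (by simp)
  have h2 := hA Complex.I (by simp)
  simp only [map_one, one_mul, Complex.conj_I] at h1 h2
  have hP : planarCoeff (fun z => h (L z)) (m + 2) = 0 := by
    rw [h1] at h2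
    have : Complex.I * planarCoeff (fun z => h (L z)) (m + 2) = 0 := by linear_combination h2
    simpa using this
  exact ⟨hP, by rw [h1, hP, mul_zero]⟩

theorem PlanarVanish.add_two {m : ℕ} (hc : Continuous h)
    (hh : ∀ r : ℝ, 0 < r → ∀ x, h (r • x) = r * h x) (hV : PlanarVanish h m) :
    PlanarVanish h (m + 2) :=
  fun L => (hV.raising_lowering hc hh L).1

/-- The lowering identity at order m + 2 has integrand h(Lz) z^m times a radial weight, so it is a
multiple of the circle coefficient of order m. The multiple contains m - 1, whence m ≠ 1. -/
theorem PlanarVanish.of_add_two {m : ℕ} (hc : Continuous h)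
    (hh : ∀ r : ℝ, 0 < r → ∀ x, h (r • x) = r * h x) (hm : m ≠ 1)
    (hV : PlanarVanish h (m + 2)) : PlanarVanish h m := by
  intro L
  have hg : ∀ r : ℝ, 0 < r → ∀ z : ℂ, h (L (r * z)) = r * h (L z) := fun r hr z => by
    rw [← Complex.real_smul, map_smul, hh r hr]
  rw [← circleCoeff_eq_zero_iff hg]
  have h1 := (hV.raising_lowering hc hh L).2
  have h2 := integral_lowering_weight (g := fun z => h (L z)) hg m
  have h3 : (((m : ℝ) - 1) / 2 * radialMoment (m + 4) : ℝ) *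
      circleCoeff (fun z => h (L z)) m = 0 := by
    rw [← h2, ← h1]
    congr 1
    ext z
    have e1 : m + 2 - 1 = m + 1 := rfl
    have e2 : ((‖z‖ ^ 2 : ℝ) : ℂ) = z * (starRingEnd ℂ) z := by
      push_cast
      rw [← Complex.mul_conj']
    have e4 : (((((m : ℝ) + 2) * ‖z‖ ^ 2 - 1 / 2 * ‖z‖ ^ 4) *
      Real.exp (-(1 / 2) * ‖z‖ ^ 2) : ℝ) : ℂ) = (((m : ℂ) + 2) * ((‖z‖ ^ 2 : ℝ) : ℂ) -
        1 / 2 * ((‖z‖ ^ 2 : ℝ) : ℂ) ^ 2) * (Real.exp (-(1 / 2) * ‖z‖ ^ 2) : ℝ) := by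
      push_cast
      ring
    rw [e4, e1, e2]
    push_cast
    ring
  rcases mul_eq_zero.1 h3 with h4 | h4
  · rw [Complex.ofReal_eq_zero] at h4
    have hm' : (m : ℝ) - 1 ≠ 0 := fun h0 => hm (by exact_mod_cast sub_eq_zero.1 h0)
    exact absurd h4 (mul_ne_zero (div_ne_zero hm' two_ne_zero) (radialMoment_pos _).ne')
  · exact h4

theorem PlanarVanish.zero_of_even {m : ℕ} (hc : Continuous h)
    (hh : ∀ r : ℝ, 0 < r → ∀ x, h (r • x) = r * h x) (hm : Even m) (hV : PlanarVanish h m) :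
    PlanarVanish h 0 := by
  obtain ⟨k, rfl⟩ := hm
  induction k with
  | zero => exact hV
  | succ k ih =>
    rw [show k + 1 + (k + 1) = k + k + 2 by ring] at hV
    exact ih (hV.of_add_two hc hh (by omega))

/-- Descend to order 3, then climb. Order 1 is rightly absent: adding a linear function to h, as a
translation of K does, changes the planar coefficients of order 1 only. -/
theorem PlanarVanish.all_odd {m : ℕ} (hc : Continuous h)
    (hh : ∀ r : ℝ, 0 < r → ∀ x, h (r • x) = r * h x) (hm : Odd m) (hV : PlanarVanish h m)
    (k : ℕ) : PlanarVanish h (2 * k + 3) := by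
  have h3 : PlanarVanish h 3 := by
    obtain ⟨j, rfl⟩ := hm
    match j with
    | 0 => exact hV.add_two hc hh
    | j + 1 =>
      induction j with
      | zero => exact hV
      | succ j ih =>
        rw [show 2 * (j + 1 + 1) + 1 = 2 * (j + 1) + 1 + 2 by ring] at hV
        exact ih (hV.of_add_two hc hh (by omega))
  induction k with
  | zero => exact h3
  | succ k ih => exact ih.add_two hc hh

end Ladder

/-! ### Reduction to planes. -/

section Reduction

open Matrix

/-- Take A with rows L 1, L i and zeros below. Then h ∘ Aᵀ depends on the first two coordinates
only, and the first two basis vectors form an isotropic pair. -/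
theorem planarVanish_of_coeffsVanish {k m : ℕ} {h : EuclideanSpace ℝ (Fin (k + 2)) → ℝ}
    (hV : ∀ A, CoeffsVanish h m A) : PlanarVanish h m := by
  intro L
  set A : Matrix (Fin (k + 2)) (Fin (k + 2)) ℝ := Matrix.of fun j i =>
    if j = 0 then L 1 i else if j = 1 then L Complex.I i else 0
  have hA : ∀ x : EuclideanSpace ℝ (Fin (k + 2)),
      toEuclideanLin Aᵀ x = L (x 0 + x 1 * Complex.I) := by
    intro x
    have e : L (x 0 + x 1 * Complex.I) = x 0 • L 1 + x 1 • L Complex.I := by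
      rw [← map_smul, ← map_smul, ← map_add]
      simp
    rw [e]
    ext i
    simp only [Matrix.toLpLin_apply, Matrix.mulVec, dotProduct, Matrix.transpose_apply, A,
      Matrix.of_apply, PiLp.add_apply, PiLp.smul_apply, smul_eq_mul]
    rw [Fin.sum_univ_succ, Fin.sum_univ_succ]
    simp [Fin.ext_iff, mul_comm]
  have h1 := hV A (EuclideanSpace.single 0 1) (EuclideanSpace.single 1 1)
    (by rw [EuclideanSpace.inner_single_left]; simp)
    (by rw [PiLp.norm_single, PiLp.norm_single])
  have h2 := integral_planar_projection k (fun z => (h (L z) : ℂ) * z ^ m)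
  have h3 : ∫ x : EuclideanSpace ℝ (Fin (k + 2)), (h (L (x 0 + x 1 * Complex.I)) : ℂ) *
      (x 0 + x 1 * Complex.I) ^ m * (Real.exp (-(1 / 2) * ‖x‖ ^ 2) : ℝ) = 0 := by
    rw [← h1, gaussCoeff]
    congr 1
    ext x
    rw [hA]
    simp [EuclideanSpace.inner_single_left]
  rw [h3] at h2
  have hpos : 0 < ∫ x : ℝ, Real.exp (-(1 / 2) * x ^ 2) := by
    rw [integral_gaussian]
    positivity
  rcases mul_eq_zero.1 h2.symm with h4 | h4
  · exact h4
  · exact absurd (Complex.ofReal_eq_zero.1 h4) (pow_ne_zero _ hpos.ne')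

end Reduction

/-! ### Consequences for the odd and even parts. -/

section OddPart

/-- A continuous odd homogeneous function on the plane whose Fourier coefficients of odd order at
least three vanish is additive. -/
theorem additive_of_circleCoeff {f : ℂ → ℝ} (hc : Continuous f)
    (hf : ∀ r : ℝ, 0 < r → ∀ z, f (r * z) = r * f z) (hodd : ∀ z, f (-z) = -f z)
    (h3 : ∀ k, circleCoeff f (2 * k + 3) = 0) (z w : ℂ) : f (z + w) = f z + f w := by
  have hT : Fact (0 < 2 * Real.pi) := ⟨Real.two_pi_pos⟩
  have heven : ∀ k, circleCoeff f (2 * k) = 0 := by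
    intro k
    rw [circleCoeff_eq_zero_iff hf, planarCoeff]
    have h1 := integral_neg_eq_self (fun z : ℂ => (f z : ℂ) * z ^ (2 * k) *
      (Real.exp (-(1 / 2) * ‖z‖ ^ 2) : ℝ)) volume
    have h2 : ∫ z : ℂ, (f (-z) : ℂ) * (-z) ^ (2 * k) * (Real.exp (-(1 / 2) * ‖-z‖ ^ 2) : ℝ) =
        - ∫ z : ℂ, (f z : ℂ) * z ^ (2 * k) * (Real.exp (-(1 / 2) * ‖z‖ ^ 2) : ℝ) := by
      rw [← integral_neg]
      congr 1
      ext z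
      rw [hodd, norm_neg, Even.neg_pow (even_two_mul k)]
      push_cast
      ring
    rw [h2] at h1
    exact self_eq_neg.1 h1.symm
  have hall : ∀ m : ℕ, m ≠ 1 → circleCoeff f m = 0 := by
    intro m hm
    rcases Nat.even_or_odd' m with ⟨k, rfl | rfl⟩
    · exact heven k
    · obtain ⟨j, rfl⟩ : ∃ j, k = j + 1 := Nat.exists_eq_succ_of_ne_zero (by omega)
      exact h3 j
  let φ : C(AddCircle (2 * Real.pi), ℂ) :=
    ⟨fun x => (f (AddCircle.toCircle x : ℂ) : ℂ), by
      have : Continuous fun x : AddCircle (2 * Real.pi) => (AddCircle.toCircle x : ℂ) :=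
        continuous_subtype_val.comp AddCircle.continuous_toCircle
      fun_prop⟩
  have hcirc : ∀ θ : ℝ, ((AddCircle.toCircle (θ : AddCircle (2 * Real.pi)) : Circle) : ℂ) =
      Complex.exp (θ * Complex.I) := fun θ => by
    rw [AddCircle.toCircle_apply_mk, Circle.coe_exp]
    congr 2
    field_simp
  have hint : ∀ G : ℝ → ℂ, ∫ x in (-Real.pi)..(-Real.pi + 2 * Real.pi), G x =
      ∫ x in Set.Ioo (-Real.pi) Real.pi, G x := fun G => by
    rw [show -Real.pi + 2 * Real.pi = Real.pi by ring,
      intervalIntegral.integral_of_le (by linarith [Real.pi_pos]), integral_Ioc_eq_integral_Ioo]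
  have hfneg : ∀ m : ℕ, m ≠ 1 → fourierCoeff φ (-(m : ℤ)) = 0 := by
    intro m hm
    rw [fourierCoeff_eq_intervalIntegral _ _ (-Real.pi), hint]
    have : ∫ x in Set.Ioo (-Real.pi) Real.pi, (fourier (-(-(m : ℤ))))
        (x : AddCircle (2 * Real.pi)) • φ x = circleCoeff f m := by
      rw [circleCoeff]
      congr 1
      ext θ
      simp only [neg_neg, fourier_apply, smul_eq_mul, φ, ContinuousMap.coe_mk, natCast_zsmul,
        AddCircle.toCircle_nsmul, Circle.coe_pow, hcirc]
      ring
    rw [this, hall m hm, smul_zero]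
  have hfpos : ∀ m : ℕ, m ≠ 1 → fourierCoeff φ (m : ℤ) = 0 := by
    intro m hm
    rw [fourierCoeff_eq_intervalIntegral _ _ (-Real.pi), hint]
    have : ∫ x in Set.Ioo (-Real.pi) Real.pi, (fourier (-(m : ℤ)))
        (x : AddCircle (2 * Real.pi)) • φ x = (starRingEnd ℂ) (circleCoeff f m) := by
      rw [circleCoeff, ← integral_conj]
      congr 1
      ext θ
      rw [fourier_neg]
      simp only [fourier_apply, smul_eq_mul, φ, ContinuousMap.coe_mk, natCast_zsmul,
        AddCircle.toCircle_nsmul, Circle.coe_pow, hcirc, map_mul, Complex.conj_ofReal]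
      ring
    rw [this, hall m hm, map_zero, smul_zero]
  have hF : ∀ i : ℤ, i ∉ ({1, -1} : Finset ℤ) → fourierCoeff φ i = 0 := by
    intro i hi
    simp only [Finset.mem_insert, Finset.mem_singleton, not_or] at hi
    obtain ⟨m, rfl | rfl⟩ := i.eq_nat_or_neg
    · exact hfpos m (by rintro rfl; simp at hi)
    · exact hfneg m (by rintro rfl; simp at hi)
  -- Only the frequencies ±1 survive, so the Fourier series is finite and represents the continuous
  -- φ pointwise.
  have hsum : ∀ x, φ x = ∑ i ∈ ({1, -1} : Finset ℤ), fourierCoeff φ i • fourier i x := fun x =>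
    (has_pointwise_sum_fourier_series_of_summable
      (summable_of_ne_finset_zero (s := {1, -1}) hF) x).unique
      (hasSum_sum_of_ne_finset_zero fun i hi => by rw [hF i hi, zero_smul])
  obtain ⟨a, b, hab⟩ : ∃ a b : ℂ, ∀ z : ℂ, (f z : ℂ) = a * z + b * (starRingEnd ℂ) z := by
    refine ⟨fourierCoeff φ 1, fourierCoeff φ (-1), fun z => ?_⟩
    have hu : ∀ θ : ℝ, (f (Complex.exp (θ * Complex.I)) : ℂ) =
        fourierCoeff φ 1 * Complex.exp (θ * Complex.I) +
          fourierCoeff φ (-1) * (starRingEnd ℂ) (Complex.exp (θ * Complex.I)) := by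
      intro θ
      have := hsum (θ : AddCircle (2 * Real.pi))
      rw [Finset.sum_pair (by norm_num)] at this
      rw [fourier_neg] at this
      simpa only [φ, ContinuousMap.coe_mk, hcirc, fourier_one, smul_eq_mul] using this
    by_cases hz : z = 0
    · have := hodd 0
      simp only [neg_zero] at this
      rw [hz, self_eq_neg.1 this]
      simp
    · have hz' : 0 < ‖z‖ := norm_pos_iff.2 hz
      have hz2 : z = ‖z‖ * Complex.exp (z.arg * Complex.I) :=
        (Complex.norm_mul_exp_arg_mul_I z).symm
      rw [hz2, hf _ hz', Complex.ofReal_mul, hu, map_mul, Complex.conj_ofReal]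
      ring
  have : ((f (z + w) : ℝ) : ℂ) = ((f z + f w : ℝ) : ℂ) := by
    push_cast
    rw [hab, hab, hab, map_add]
    ring
  exact_mod_cast this

variable {E : Type*} [NormedAddCommGroup E] [InnerProductSpace ℝ E] {h : E → ℝ}

/-- The linear map `ℂ → E` with given values at `1` and `i`. -/
noncomputable def planeMap (v w : E) : ℂ →L[ℝ] E :=
  Complex.reCLM.smulRight v + Complex.imCLM.smulRight w

theorem planeMap_apply (v w : E) (z : ℂ) : planeMap v w z = z.re • v + z.im • w := rfl

theorem comp_homogeneous (hh : ∀ r : ℝ, 0 < r → ∀ x, h (r • x) = r * h x) (L : ℂ →L[ℝ] E) (r : ℝ)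
    (hr : 0 < r) (z : ℂ) : h (L (r * z)) = r * h (L z) := by
  rw [← Complex.real_smul, map_smul, hh r hr]

/-- The odd part restricted to the plane of v and w is the difference of h ∘ L and h ∘ (-L), whose
odd orders from 3 on all vanish. -/
theorem PlanarVanish.odd_part_add (hc : Continuous h)
    (hh : ∀ r : ℝ, 0 < r → ∀ x, h (r • x) = r * h x) {m : ℕ} (hm : Odd m) (hV : PlanarVanish h m)
    (v w : E) : h (v + w) - h (-(v + w)) = (h v - h (-v)) + (h w - h (-w)) := by
  set L := planeMap v w
  have hg := comp_homogeneous hh L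
  have hg' := comp_homogeneous hh (-L)
  have hcirc : ∀ k, circleCoeff (fun z => h (L z) - h ((-L) z)) (2 * k + 3) = 0 := by
    intro k
    have h1 := (circleCoeff_eq_zero_iff hg _).2 (hV.all_odd hc hh hm k L)
    have h2 := (circleCoeff_eq_zero_iff hg' _).2 (hV.all_odd hc hh hm k (-L))
    have hi : ∀ M : ℂ →L[ℝ] E, IntegrableOn (fun θ : ℝ =>
        (h (M (Complex.exp (θ * Complex.I))) : ℂ) * Complex.exp (θ * Complex.I) ^ (2 * k + 3))
        (Set.Ioo (-Real.pi) Real.pi) := fun M =>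
      ((by fun_prop : Continuous _).integrableOn_Icc).mono_set Set.Ioo_subset_Icc_self
    rw [← sub_zero (0 : ℂ)]
    nth_rewrite 1 [← h1]
    rw [← h2, circleCoeff, circleCoeff, circleCoeff, ← integral_sub (hi L) (hi (-L))]
    congr 1
    ext θ
    push_cast
    ring
  have key := additive_of_circleCoeff (f := fun z => h (L z) - h ((-L) z)) (by fun_prop)
    (fun r hr z => by rw [hg r hr, hg' r hr]; ring) (fun z => by simp) hcirc 1 Complex.I
  simpa [L, planeMap_apply] using key

/-- At order 0 a non-negative continuous function has Gaussian integral zero, so it vanishes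
identically. -/
theorem PlanarVanish.even_part_eq_zero (hc : Continuous h)
    (hh : ∀ r : ℝ, 0 < r → ∀ x, h (r • x) = r * h x) (hw : ∀ x, 0 ≤ h x + h (-x)) {m : ℕ}
    (hm : Even m) (hV : PlanarVanish h m) (x : E) : h x + h (-x) = 0 := by
  -- Only L 1 = x matters.
  set L := planeMap x x
  have h0 := hV.zero_of_even hc hh hm
  have h1 := h0 L
  have h2 := h0 (-L)
  have hi : ∀ M : ℂ →L[ℝ] E, Integrable fun z : ℂ =>
      (h (M z) : ℂ) * z ^ 0 * (Real.exp (-(1 / 2) * ‖z‖ ^ 2) : ℝ) := fun M => by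
    simpa using integrable_ladder_term hc hh M 0 0
  have h3 : ∫ z : ℂ, (((h (L z) + h (-(L z))) * Real.exp (-(1 / 2) * ‖z‖ ^ 2) : ℝ) : ℂ) = 0 := by
    have := integral_add (hi L) (hi (-L))
    rw [planarCoeff] at h1 h2
    rw [h1, h2, add_zero] at this
    rw [← this]
    congr 1
    ext z
    rw [neg_apply]
    push_cast
    ring
  have hi2 : Integrable fun z : ℂ =>
      (((h (L z) + h (-(L z))) * Real.exp (-(1 / 2) * ‖z‖ ^ 2) : ℝ) : ℂ) := by
    refine ((hi L).add (hi (-L))).congr (Filter.Eventually.of_forall fun z => ?_)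
    simp only [Pi.add_apply, neg_apply]
    push_cast
    ring
  rw [integral_complex_ofReal, Complex.ofReal_eq_zero, integral_eq_zero_iff_of_nonneg
    (fun z => mul_nonneg (hw _) (Real.exp_pos _).le) (by exact hi2.re)] at h3
  have hcont : Continuous fun z : ℂ =>
      (h (L z) + h (-(L z))) * Real.exp (-(1 / 2) * ‖z‖ ^ 2) :=
    ((hc.comp L.continuous).add (hc.comp L.continuous.neg)).mul (by fun_prop)
  have h4 := (Continuous.ae_eq_iff_eq volume hcont continuous_const).1 h3
  have h5 : (h (L 1) + h (-(L 1))) * Real.exp (-(1 / 2) * ‖(1 : ℂ)‖ ^ 2) = 0 := congrFun h4 1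
  have h6 := (mul_eq_zero.1 h5).resolve_right (Real.exp_ne_zero _)
  simpa [L, planeMap_apply] using h6

end OddPart

/-! ### Support functions of points and of symmetric bodies. -/

section SupportFunction

variable {E : Type*} [NormedAddCommGroup E] [InnerProductSpace ℝ E]

theorem continuous_supportFun {K : Set E} (hK : IsCompact K) : Continuous (supportFun K) :=
  hK.continuous_sSup (by fun_prop)

theorem supportFun_smul (K : Set E) (r : ℝ) (hr : 0 < r) (x : E) :
    supportFun K (r • x) = r * supportFun K x := by
  rw [supportFun, supportFun, ← smul_eq_mul, ← Real.sSup_smul_of_nonneg hr.le]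
  congr 1
  ext y
  simp [Set.mem_smul_set, inner_smul_left]

theorem le_supportFun {K : Set E} (hK : IsCompact K) (x : E) {y : E} (hy : y ∈ K) :
    inner ℝ x y ≤ supportFun K x :=
  le_csSup (hK.image (by fun_prop)).bddAbove (Set.mem_image_of_mem _ hy)

theorem supportFun_add_neg_nonneg {K : Set E} (hK : IsCompact K) (hne : K.Nonempty) (x : E) :
    0 ≤ supportFun K x + supportFun K (-x) := by
  obtain ⟨y, hy⟩ := hne
  have h1 := le_supportFun hK x hy
  have h2 := le_supportFun hK (-x) hy
  rw [inner_neg_left] at h2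
  linarith

theorem mem_of_forall_inner_le_supportFun [CompleteSpace E] {K : Set E} (hK : IsCompact K)
    (hconv : Convex ℝ K) (hne : K.Nonempty) {y : E} (hy : ∀ x, inner ℝ x y ≤ supportFun K x) :
    y ∈ K := by
  by_contra hyK
  obtain ⟨f, u, hfu, huy⟩ := geometric_hahn_banach_closed_point hconv hK.isClosed hyK
  set x := (InnerProductSpace.toDual ℝ E).symm f
  have hx : ∀ z, inner ℝ x z = f z := fun z => InnerProductSpace.toDual_symm_apply
  have h1 : supportFun K x ≤ u := by
    refine csSup_le (hne.image _) ?_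
    rintro _ ⟨z, hz, rfl⟩
    simp only [hx]
    exact (hfu z hz).le
  have h2 := hy x
  rw [hx] at h2
  linarith

theorem subsingleton_of_width_eq_zero {K : Set E} (hK : IsCompact K)
    (hw : ∀ x, supportFun K x + supportFun K (-x) = 0) : K.Subsingleton := by
  intro x hx y hy
  have h1 := le_supportFun hK (x - y) hx
  have h2 := le_supportFun hK (-(x - y)) hy
  have h3 := hw (x - y)
  rw [inner_neg_left] at h2
  have h4 : inner ℝ (x - y) (x - y) ≤ 0 := by
    rw [inner_sub_right]
    linarith
  exact sub_eq_zero.1 (real_inner_self_nonpos.1 h4)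

/-- An additive continuous odd part is ⟨d, ·⟩ for some d. For x in K, ⟨z, d - x⟩ ≤ ⟨z, d⟩ + h(-z) =
h(z) for all z, so d - x lies in K and d / 2 is a centre. -/
theorem exists_centre_of_additive_odd_part [FiniteDimensional ℝ E] {K : Set E} (hK : IsCompact K)
    (hconv : Convex ℝ K) (hne : K.Nonempty)
    (hadd : ∀ v w, supportFun K (v + w) - supportFun K (-(v + w)) =
      (supportFun K v - supportFun K (-v)) + (supportFun K w - supportFun K (-w))) :
    ∃ c : E, ∀ x ∈ K, (2 : ℝ) • c - x ∈ K := by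
  have : CompleteSpace E := FiniteDimensional.complete ℝ E
  let φ : E →+ ℝ := AddMonoidHom.mk' (fun x => supportFun K x - supportFun K (-x)) hadd
  have hφc : Continuous φ :=
    (continuous_supportFun hK).sub ((continuous_supportFun hK).comp continuous_neg)
  let ψ : E →L[ℝ] ℝ := φ.toRealLinearMap hφc
  set d := (InnerProductSpace.toDual ℝ E).symm ψ
  have hd : ∀ z, inner ℝ d z = supportFun K z - supportFun K (-z) := fun z =>
    InnerProductSpace.toDual_symm_apply
  refine ⟨(1 / 2 : ℝ) • d, fun x hx => ?_⟩
  refine mem_of_forall_inner_le_supportFun hK hconv hne fun z => ?_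
  have h1 := le_supportFun hK (-z) hx
  rw [smul_smul, show (2 : ℝ) * (1 / 2) = 1 by norm_num, one_smul, inner_sub_right,
    real_inner_comm, hd]
  rw [inner_neg_left] at h1
  linarith

end SupportFunction

/-! ### Conclusion. -/

theorem ae_harmonicProj_ne_zero {n : ℕ} (hn : 2 ≤ n) (K : ConvexBody (EuclideanSpace ℝ (Fin n)))
    (m : ℕ) (hm : Even m ∧ (K : Set (EuclideanSpace ℝ (Fin n))).Nontrivial ∨
      Odd m ∧ ¬ HasCentreOfSymmetry K) :
    ∀ᵐ a : Fin n → Fin n → ℝ ∂volume,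
      harmonicProj n m (supportFn (linearImage (Matrix.of a) K)) ≠ 0 := by
  obtain ⟨k, rfl⟩ := Nat.exists_eq_add_of_le' hn
  set h := supportFun (K : Set (EuclideanSpace ℝ (Fin (k + 2))))
  have hc : Continuous h := continuous_supportFun K.isCompact
  have hh : ∀ r : ℝ, 0 < r → ∀ x, h (r • x) = r * h x := supportFun_smul _
  have hex : ∃ A, ¬ CoeffsVanish h m A := by
    by_contra hall
    push Not at hall
    have hV := planarVanish_of_coeffsVanish hall
    rcases hm with ⟨hm, hK⟩ | ⟨hm, hK⟩
    · exact Set.not_subsingleton_iff.2 hK (subsingleton_of_width_eq_zero K.isCompact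
        (hV.even_part_eq_zero hc hh (supportFun_add_neg_nonneg K.isCompact K.nonempty) hm))
    · exact hK (exists_centre_of_additive_odd_part K.isCompact K.convex K.nonempty
        (hV.odd_part_add hc hh hm))
  filter_upwards [ae_not_coeffsVanish (by omega) hc hh hex] with a ha h0
  refine ha fun p q hpq hpn => ?_
  refine gaussCoeff_eq_zero_of_harmonicProj_eq_zero (by omega) (fun r hr x => ?_)
    (supportFn_linearImage K (Matrix.of a)) h0 hpq hpn
  rw [map_smul]
  exact hh r hr _

theorem nontrivial_of_not_hasCentreOfSymmetry {n : ℕ}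
    {K : ConvexBody (EuclideanSpace ℝ (Fin n))} (hK : ¬ HasCentreOfSymmetry K) :
    (K : Set (EuclideanSpace ℝ (Fin n))).Nontrivial := by
  by_contra hs
  rw [Set.not_nontrivial_iff] at hs
  obtain ⟨c, hcK⟩ := K.nonempty
  refine hK ⟨c, fun x hx => ?_⟩
  have : x = c := hs hx hcK
  rw [this, two_smul, add_sub_cancel_right]
  exact hcK

/-- The complement of a null set is dense, so it meets every neighbourhood of the identity, also
after the singular matrices are discarded. -/
theorem exists_mem_and_ae_mem_of_ae {n : ℕ} {P : Matrix (Fin n) (Fin n) ℝ → Prop}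
    (hP : ∀ᵐ a : Fin n → Fin n → ℝ ∂volume, P (Matrix.of a))
    {U : Set (Matrix (Fin n) (Fin n) ℝ)} (hU : U ∈ 𝓝 (1 : Matrix (Fin n) (Fin n) ℝ)) :
    (∃ A ∈ U, A.det ≠ 0 ∧ P A) ∧
      (∀ᵐ a : Fin n → Fin n → ℝ ∂volume, Matrix.of a ∈ U → P (Matrix.of a)) := by
  refine ⟨?_, hP.mono fun a ha _ => ha⟩
  have h1 : ∀ᵐ a : Fin n → Fin n → ℝ ∂volume, (Matrix.of a).det ≠ 0 :=
    ae_iff.2 (by simpa using volume_det_eq_zero)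
  have hdense : Dense {a : Fin n → Fin n → ℝ | (Matrix.of a).det ≠ 0 ∧ P (Matrix.of a)} :=
    Measure.dense_of_ae (μ := volume) (h1.and hP)
  have hU' : Matrix.of ⁻¹' U ∈ 𝓝 (Matrix.of.symm (1 : Matrix (Fin n) (Fin n) ℝ)) := hU
  obtain ⟨a, haU, ha⟩ := mem_closure_iff_nhds.1 (hdense (Matrix.of.symm 1)) _ hU'
  exact ⟨Matrix.of a, haU, ha⟩

theorem theorem3 (n : ℕ) (hn : 2 ≤ n) (K : ConvexBody (EuclideanSpace ℝ (Fin n))) :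
    (¬ HasCentreOfSymmetry K →
      ∀ U ∈ 𝓝 (1 : Matrix (Fin n) (Fin n) ℝ),
        (∃ A ∈ U, A.det ≠ 0 ∧ IsUniversal (linearImage A K)) ∧
        (∀ᵐ a : Fin n → Fin n → ℝ ∂volume,
          Matrix.of a ∈ U → IsUniversal (linearImage (Matrix.of a) K))) ∧
    ((K : Set (EuclideanSpace ℝ (Fin n))).Nontrivial →
      ∀ U ∈ 𝓝 (1 : Matrix (Fin n) (Fin n) ℝ),
        (∃ A ∈ U, A.det ≠ 0 ∧ IsCentrallyUniversal (linearImage A K)) ∧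
        (∀ᵐ a : Fin n → Fin n → ℝ ∂volume,
          Matrix.of a ∈ U → IsCentrallyUniversal (linearImage (Matrix.of a) K))) := by
  refine ⟨fun hK U hU => exists_mem_and_ae_mem_of_ae (P := fun A => IsUniversal (linearImage A K))
    (ae_all_iff.2 fun m => ae_harmonicProj_ne_zero hn K m ?_) hU,
    fun hK U hU => exists_mem_and_ae_mem_of_ae
      (P := fun A => IsCentrallyUniversal (linearImage A K))
      (ae_all_iff.2 fun m => ?_) hU⟩
  · exact (Nat.even_or_odd m).imp (fun h => ⟨h, nontrivial_of_not_hasCentreOfSymmetry hK⟩)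
      (fun h => ⟨h, hK⟩)
  · by_cases hm : Even m
    · exact (ae_harmonicProj_ne_zero hn K m (Or.inl ⟨hm, hK⟩)).mono fun _ h _ => h
    · exact Filter.Eventually.of_forall fun _ h => absurd h hm
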